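/- Let $V$ be a set of $n\ge 2$ parties, each holding a system with Hilbert space $\mathbb{C}^d$. A state is a density matrix $\rho$ on $(\mathbb{C}^d)^{\otimes V}$. For a permutation $\pi$ of $V$ let $U_\pi$ denote the unitary that permutes the tensor factors accordingly. The state $\rho$ is called symmetric if $U_\pi\rho=\rho$ for all $\pi$, and anti-symmetric if $U_\pi\rho=\operatorname{sgn}(\pi)\rho$ for all $\pi$ (that is, the range of $\rho$ lies in the symmetric, respectively the anti-symmetric, subspace). A network is a hypergraph $G$ with node set $V$ none of whose hyperedges is all of $V$. A $G$ state is a state $\bigotimes_{e}\tau_e$, where for each hyperedge $e$ the source state $\tau_e$ is an arbitrary density matrix on a tensor product $\bigotimes_{v\in e}\mathcal{H}_{e,v}$ of finite-dimensional spaces (of any dimensions), and each party $v$ receives all the particles $\mathcal{H}_{e,v}$ with $e\ni v$. Let $\mathcal{S}_{\rm C}(G)$ be the closure of the set of states $\sum_{\lambda}p_\lambda\bigl(\bigotimes_{v\in V}C_v^{(\lambda)}\bigr)[\tau]$ on $(\mathbb{C}^d)^{\otimes V}$ that can be prepared from a $G$ state $\tau$ by local operations and shared randomness (LOSR), where $(p_\lambda)$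 is a finite probability distribution and each $C_v^{(\lambda)}$ is a quantum channel acting on the particles of party $v$. The network-entanglement weight is $$\mathcal{E}_w(\rho|G)=\min\{\,p : \rho\succeq(1-p)\sigma \text{ for some } \sigma\in\mathcal{S}_{\rm C}(G)\,\},$$ and the ordinary entanglement weight $\mathcal{E}_w(\rho)$ is defined in the same way, with $\mathcal{S}_{\rm C}(G)$ replaced by the set of fully separable states (finite convex mixtures of product states $\bigotimes_{v\in V}\omega_v$). 1. If $\rho$ is anti-symmetric, then for every network $G$ on $V$ the minimum defining $\mathcal{E}_w(\rho|G)$ is attained and $\mathcal{E}_w(\rho|G)=1$. 2. If $\rho$ is symmetric, then for every network $G$ on $V$ the minima defining $\mathcal{E}_w(\rho|G)$ and $\mathcal{E}_w(\rho)$ are attained and $\mathcal{E}_w(\rho|G)=\mathcal{E}_w(\rho)$; in particular $\mathcal{E}_w(\rho|G)=\mathcal{E}_w(\rho|G')$ for any two networks $G,G'$ on $V$, so that the weight does not depend on the network topology. -/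

import Mathlib

open scoped BigOperators Matrix ComplexOrder

noncomputable section

namespace QuantumNetwork

/-! ### States -/

/-- Density matrices on the space with orthonormal basis `n`. -/
def IsDensity {n : Type*} [Fintype n] (ρ : Matrix n n ℂ) : Prop :=
  ρ.PosSemidef ∧ ρ.trace = 1

/-- Operators on the space `(ℂ^d)^{⊗ V}` of the parties `V`, in the product basis `V → Fin d`. -/
abbrev Operator (V : Type*) (d : ℕ) : Type _ :=
  Matrix (V → Fin d) (V → Fin d) ℂ

/-- The unitary that permutes the tensor factors of `(ℂ^d)^{⊗ V}` according to `π`. -/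
def permOperator {V : Type*} [Fintype V] (d : ℕ) (π : Equiv.Perm V) : Operator V d :=
  Matrix.of fun x y => if x ∘ π = y then 1 else 0

/-- Symmetric operators: the range lies in the symmetric subspace. -/
def IsSymmetricState {V : Type*} [Fintype V] [DecidableEq V] {d : ℕ} (ρ : Operator V d) : Prop :=
  ∀ π : Equiv.Perm V, permOperator d π * ρ = ρ

/-- Anti-symmetric operators: the range lies in the anti-symmetric subspace. -/
def IsAntisymmetricState {V : Type*} [Fintype V] [DecidableEq V] {d : ℕ}
    (ρ : Operator V d) : Prop :=
  ∀ π : Equiv.Perm V, permOperator d π * ρ = ((Equiv.Perm.sign π : ℤ) : ℂ) • ρ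

/-- The tensor product `⊗_v A_v` of one operator `A_v` for each party. -/
def tensor {V : Type*} [Fintype V] {α β : V → Type*} (A : ∀ v, Matrix (α v) (β v) ℂ) :
    Matrix (∀ v, α v) (∀ v, β v) ℂ :=
  Matrix.of fun x y => ∏ v, A v (x v) (y v)

/-- Fully separable states: finite convex mixtures of product states. -/
def separableStates (V : Type*) [Fintype V] (d : ℕ) : Set (Operator V d) :=
  convexHull ℝ {σ | ∃ ω : V → Matrix (Fin d) (Fin d) ℂ, (∀ v, IsDensity (ω v)) ∧ σ = tensor ω}

/-! ### Local operations and shared randomness -/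

/-- A quantum channel from the space with basis `m` to the space with basis `k`, given by a finite
Kraus decomposition `X ↦ ∑ i, Kᵢ X Kᵢᴴ`. -/
structure Channel (m k : Type*) [Fintype m] [DecidableEq m] [Fintype k] where
  rank : ℕ
  kraus : Fin rank → Matrix k m ℂ
  trace_preserving : ∑ i, (kraus i)ᴴ * kraus i = 1

/-- The tensor product channel `⊗_v C_v` applied to a joint operator `X`: its Kraus operators are
the tensor products of the local ones. -/
def applyLocal {V : Type*} [Fintype V] [DecidableEq V] {α β : V → Type*}
    [∀ v, Fintype (α v)] [∀ v, DecidableEq (α v)] [∀ v, Fintype (β v)]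
    (C : ∀ v, Channel (α v) (β v)) (X : Matrix (∀ v, α v) (∀ v, α v) ℂ) :
    Matrix (∀ v, β v) (∀ v, β v) ℂ :=
  ∑ i : (∀ v, Fin (C v).rank),
    tensor (fun v => (C v).kraus (i v)) * X * (tensor (fun v => (C v).kraus (i v)))ᴴ

/-- `σ` results from `X` by local operations of the parties, coordinated by a shared random
variable `l` that is independent of `X`. -/
def IsLOSRImage {V : Type*} [Fintype V] [DecidableEq V] {α β : V → Type*}
    [∀ v, Fintype (α v)] [∀ v, DecidableEq (α v)] [∀ v, Fintype (β v)]
    (X : Matrix (∀ v, α v) (∀ v, α v) ℂ) (σ : Matrix (∀ v, β v) (∀ v, β v) ℂ) : Prop :=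
  ∃ (N : ℕ) (p : Fin N → ℝ) (C : Fin N → ∀ v, Channel (α v) (β v)),
    (∀ l, 0 ≤ p l) ∧ ∑ l, p l = 1 ∧ σ = ∑ l, p l • applyLocal (C l) X

/-! ### Networks -/

/-- A network of the parties `V`: a hypergraph whose nodes are all the parties, in which no single
source (hyperedge) reaches all the parties. -/
def IsNetwork {V : Type*} (G : Hypergraph V) : Prop :=
  G.vertexSet = Set.univ ∧ ∀ e ∈ G.edgeSet, e ≠ Set.univ

/-- Basis of the particles emitted by the source `e`; the particle that it sends to `v ∈ e` has
dimension `D e v`. -/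
def SourceBasis {V : Type*} (D : Set V → V → ℕ) (e : Set V) : Type _ :=
  (v : e) → Fin (D e v)

instance {V : Type*} [Finite V] (D : Set V → V → ℕ) (e : Set V) : Fintype (SourceBasis D e) :=
  have : Finite (SourceBasis D e) := inferInstanceAs (Finite ((v : e) → Fin (D e v)))
  Fintype.ofFinite _

/-- Basis of the particles received by the party `v` from all the sources incident to `v`. -/
def PartyBasis {V : Type*} (G : Hypergraph V) (D : Set V → V → ℕ) (v : V) : Type _ :=
  (e : {e : Set V // e ∈ G.edgeSet ∧ v ∈ e}) → Fin (D e v)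

instance {V : Type*} [Finite V] (G : Hypergraph V) (D : Set V → V → ℕ) (v : V) :
    Fintype (PartyBasis G D v) :=
  have : Finite (PartyBasis G D v) :=
    inferInstanceAs (Finite ((e : {e : Set V // e ∈ G.edgeSet ∧ v ∈ e}) → Fin (D e v)))
  Fintype.ofFinite _

instance {V : Type*} (G : Hypergraph V) (D : Set V → V → ℕ) (v : V) :
    DecidableEq (PartyBasis G D v) :=
  Classical.decEq _

instance {V : Type*} [Finite V] (G : Hypergraph V) : Fintype G.edgeSet :=
  Fintype.ofFinite _

/-- The joint state `⊗_e τ_e` of independent sources `τ_e`, with the particles grouped by the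
party that holds them. -/
def distribute {V : Type*} [Finite V] (G : Hypergraph V) (D : Set V → V → ℕ)
    (τ : ∀ e : G.edgeSet, Matrix (SourceBasis D (e : Set V)) (SourceBasis D (e : Set V)) ℂ) :
    Matrix (∀ v, PartyBasis G D v) (∀ v, PartyBasis G D v) ℂ :=
  Matrix.of fun a b => ∏ e : G.edgeSet,
    τ e (fun v => a v ⟨e, e.2, v.2⟩) (fun v => b v ⟨e, e.2, v.2⟩)

/-- The set `S_C(G)`: the closure of the set of states on `(ℂ^d)^{⊗ V}` that can be prepared by
LOSR from the states that the sources of `G` can distribute. -/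
def networkStates {V : Type*} [Fintype V] [DecidableEq V] (G : Hypergraph V) (d : ℕ) :
    Set (Operator V d) :=
  closure {σ | ∃ (D : Set V → V → ℕ)
    (τ : ∀ e : G.edgeSet, Matrix (SourceBasis D (e : Set V)) (SourceBasis D (e : Set V)) ℂ),
      (∀ e, IsDensity (τ e)) ∧ IsLOSRImage (distribute G D τ) σ}

/-! ### Weights -/

/-- The `p` with `ρ ⪰ (1 - p) σ` for some free state `σ ∈ F`. -/
def feasibleWeights {n : Type*} [Fintype n] (F : Set (Matrix n n ℂ)) (ρ : Matrix n n ℂ) : Set ℝ :=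
  {p | ∃ σ ∈ F, (ρ - (1 - p) • σ).PosSemidef}

/-- The network-entanglement weight `E_w(ρ|G)`. -/
def networkWeight {V : Type*} [Fintype V] [DecidableEq V] {d : ℕ} (G : Hypergraph V)
    (ρ : Operator V d) : ℝ :=
  sInf (feasibleWeights (networkStates G d) ρ)

/-- The ordinary entanglement weight: the free states are the fully separable ones. -/
def entanglementWeight {V : Type*} [Fintype V] [DecidableEq V] {d : ℕ} (ρ : Operator V d) : ℝ :=
  sInf (feasibleWeights (separableStates V d) ρ)

end QuantumNetwork

end

/-! For a sign `ε = ±1`, the defect `1 - ε Tr(F γ)`, with `F` a swap of two parties, is half the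
expectation in `γ` of `(1 - εF)ᴴ(1 - εF)`. It is therefore nonnegative, affine in the state, and
obeys a triangle inequality up to constants (`swapDefect_trans`, `swapDefect_chain`). It vanishes on
symmetric states (`ε = 1`) and, for distinct parties, on anti-symmetric ones (`ε = -1`).

The network enters through an inflation with two copies of every source and party. Since every
source misses a party, the wires can be crossed so that a chain of parties leads from one copy of
`v₀` to the other: each neighbouring pair sees an original two-party state, whereas the two ends are
independent. The end-to-end defect is thus `1 - ε Tr(m²)`, with `m` the marginal at `v₀`, and the
chain bounds it by a multiple of the total defect of the original state (`one_sub_marginal_sq_le`).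

For `ε = -1` the total defect is bounded away from zero, also on mixtures and limits, so an
anti-symmetric state has no network component of positive weight. For `ε = 1`, compactness writes
any state of `S_C(G)` as a finite mixture of states obeying the bound. If the total defect is zero,
the components of nonzero weight have pure marginals and are products (`eq_tensor_marginal`), so the
mixture is separable. Components of a symmetric state inherit zero defect; hence networks and
separable states give the same feasible weights, and compactness of the separable states gives the
minimum. -/

open scoped BigOperators Matrix ComplexOrder

noncomputable section

/-! ### Convex hulls of compact sets -/

section ConvexCompact

/-- In a finite-dimensional space the convex hull of a compact set is compact. -/
theorem IsCompact.convexHull_of_finiteDimensional {E : Type*} [AddCommGroup E] [Module ℝ E]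
    [TopologicalSpace E] [IsTopologicalAddGroup E] [ContinuousSMul ℝ E] [FiniteDimensional ℝ E]
    {s : Set E} (hs : IsCompact s) : IsCompact (convexHull ℝ s) := by
  classical
  rcases s.eq_empty_or_nonempty with rfl | ⟨x₀, hx₀⟩
  · simp
  set n := Module.finrank ℝ E + 1
  -- Carathéodory: `finrank + 1` points suffice. Shorter combinations are padded with weight `0` at
  -- the point `x₀`.
  have key : convexHull ℝ s =
      (fun q : (Fin n → ℝ) × (Fin n → E) => ∑ i, q.1 i • q.2 i) ''
        (stdSimplex ℝ (Fin n) ×ˢ Set.univ.pi fun _ => s) := by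
    apply Set.Subset.antisymm
    · intro x hx
      obtain ⟨ι, _, z, w, hz, hind, hw, hw1, rfl⟩ := eq_pos_convex_span_of_mem_convexHull hx
      have hcard : Fintype.card ι ≤ Fintype.card (Fin n) := by
        simpa [n] using hind.card_le_finrank_succ.trans
          (Nat.succ_le_succ (Submodule.finrank_le _))
      obtain ⟨f⟩ := Function.Embedding.nonempty_of_card_le hcard
      refine ⟨(Function.extend f w 0, Function.extend f z fun _ => x₀), ⟨⟨?_, ?_⟩, ?_⟩, ?_⟩
      · intro j
        by_cases hj : ∃ i, f i = j
        · obtain ⟨i, rfl⟩ := hj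
          simpa [f.injective.extend_apply] using (hw i).le
        · simp [Function.extend_apply' _ _ _ hj]
      · rw [← hw1]
        exact (Fintype.sum_of_injective f f.injective w (Function.extend f w 0)
          (fun j hj => Function.extend_apply' _ _ _ hj)
          fun i => by simp [f.injective.extend_apply]).symm
      · intro j _
        by_cases hj : ∃ i, f i = j
        · obtain ⟨i, rfl⟩ := hj
          simpa [f.injective.extend_apply] using hz ⟨i, rfl⟩
        · simpa [Function.extend_apply' _ _ _ hj] using hx₀
      · change ∑ j, Function.extend f w 0 j • Function.extend f z (fun _ => x₀) j = _
        refine (Fintype.sum_of_injective f f.injective _ _ (fun j hj => ?_)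
          fun i => by simp [f.injective.extend_apply]).symm
        rw [Function.extend_apply' _ _ _ hj]
        simp
    · rintro _ ⟨⟨w, z⟩, ⟨⟨hw0, hw1⟩, hz⟩, rfl⟩
      exact mem_convexHull_of_exists_fintype w z hw0 hw1 (fun i => hz i trivial) rfl
  rw [key]
  apply IsCompact.image
  · exact (isCompact_stdSimplex ℝ (Fin n)).prod (isCompact_univ_pi fun _ => hs)
  · fun_prop

end ConvexCompact

/-! ### Positive semidefinite matrices and purity -/

namespace Matrix

variable {n : Type*} [Fintype n]

theorem PosSemidef.exists_eq_mul_conjTranspose {ρ : Matrix n n ℂ} (h : ρ.PosSemidef) :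
    ∃ B : Matrix n n ℂ, ρ = B * Bᴴ := by
  classical
  open scoped MatrixOrder in
  obtain ⟨B, hB⟩ := CStarAlgebra.nonneg_iff_eq_star_mul_self.mp h.nonneg
  exact ⟨Bᴴ, by simpa [star_eq_conjTranspose] using hB⟩

theorem PosSemidef.trace_mul_nonneg {A ρ : Matrix n n ℂ} (hA : A.PosSemidef)
    (h : ρ.PosSemidef) : 0 ≤ (A * ρ).trace := by
  obtain ⟨B, rfl⟩ := h.exists_eq_mul_conjTranspose
  rw [← Matrix.mul_assoc, Matrix.trace_mul_comm, ← Matrix.mul_assoc]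
  exact (hA.conjTranspose_mul_mul_same B).trace_nonneg

/-- If `Tr (Aᴴ A ρ) = 0` then `A ρ = 0`. -/
theorem PosSemidef.mul_eq_zero_of_trace {A ρ : Matrix n n ℂ} (h : ρ.PosSemidef)
    (h0 : (Aᴴ * A * ρ).trace = 0) : A * ρ = 0 := by
  obtain ⟨B, rfl⟩ := h.exists_eq_mul_conjTranspose
  rw [← Matrix.mul_assoc, Matrix.trace_mul_comm, ← Matrix.mul_assoc, ← Matrix.mul_assoc,
    ← Matrix.conjTranspose_mul, Matrix.mul_assoc, trace_conjTranspose_mul_self_eq_zero_iff] at h0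
  rw [← Matrix.mul_assoc, h0, Matrix.zero_mul]

theorem PosSemidef.norm_apply_le_trace {ρ : Matrix n n ℂ} (h : ρ.PosSemidef) (i j : n) :
    ‖ρ i j‖ ≤ ρ.trace.re := by
  obtain ⟨B, rfl⟩ := h.exists_eq_mul_conjTranspose
  have hterm : ∀ i, ∑ k, ‖B i k‖ ^ 2 ≤ (B * Bᴴ).trace.re := by
    intro i
    have : (B * Bᴴ).trace.re = ∑ i, ∑ k, ‖B i k‖ ^ 2 := by
      simp [Matrix.trace, Matrix.mul_apply, Complex.mul_conj, Complex.normSq_eq_norm_sq,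
        -Complex.ofReal_pow]
    rw [this]
    exact Finset.single_le_sum (f := fun i => ∑ k, ‖B i k‖ ^ 2)
      (fun i _ => Finset.sum_nonneg fun k _ => by positivity) (Finset.mem_univ i)
  calc ‖(B * Bᴴ) i j‖ ≤ ∑ k, ‖B i k‖ * ‖B j k‖ := by
        rw [Matrix.mul_apply]
        refine (norm_sum_le _ _).trans (le_of_eq ?_)
        simp
    _ ≤ ∑ k, (‖B i k‖ ^ 2 + ‖B j k‖ ^ 2) / 2 := by
        apply Finset.sum_le_sum
        intro k _
        nlinarith [sq_nonneg (‖B i k‖ - ‖B j k‖)]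
    _ ≤ (B * Bᴴ).trace.re := by
        rw [← Finset.sum_div, Finset.sum_add_distrib]
        linarith [hterm i, hterm j]

/-- A positive semidefinite matrix with `Tr ρ = 1 ≤ Tr ρ²` is a rank-one projection. -/
theorem PosSemidef.exists_eq_vecMulVec_of_trace_sq {ρ : Matrix n n ℂ} (h : ρ.PosSemidef)
    (h1 : ρ.trace = 1) (h2 : 1 ≤ (ρ * ρ).trace.re) :
    ρ * ρ = ρ ∧ ∃ u : n → ℂ, ρ = vecMulVec u (star u) := by
  classical
  set l := h.isHermitian.eigenvalues with hl
  have hnn : ∀ i, 0 ≤ l i := h.eigenvalues_nonneg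
  set U : Matrix n n ℂ := (h.isHermitian.eigenvectorUnitary : Matrix n n ℂ) with hU
  have hUU : Uᴴ * U = 1 := by
    have := Unitary.coe_star_mul_self h.isHermitian.eigenvectorUnitary
    simpa [star_eq_conjTranspose] using this
  have hspec : ρ = U * diagonal (fun i => (l i : ℂ)) * Uᴴ := by
    have := h.isHermitian.spectral_theorem
    rw [Unitary.conjStarAlgAut_apply] at this
    exact this
  have hs1 : ∑ i, l i = 1 := by
    rw [hspec, Matrix.trace_mul_comm, ← Matrix.mul_assoc, hUU, Matrix.one_mul,
      Matrix.trace_diagonal] at h1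
    exact_mod_cast h1
  have hsq : ρ * ρ = U * diagonal (fun i => (l i : ℂ) * l i) * Uᴴ := by
    rw [hspec]
    calc U * diagonal (fun i => (l i : ℂ)) * Uᴴ * (U * diagonal (fun i => (l i : ℂ)) * Uᴴ)
        = U * diagonal (fun i => (l i : ℂ)) * (Uᴴ * U) * diagonal (fun i => (l i : ℂ)) * Uᴴ := by
          simp only [Matrix.mul_assoc]
      _ = _ := by
          rw [hUU, Matrix.mul_one, Matrix.mul_assoc U, Matrix.diagonal_mul_diagonal]
  have hs2 : 1 ≤ ∑ i, l i * l i := by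
    rw [hsq, Matrix.trace_mul_comm, ← Matrix.mul_assoc, hUU, Matrix.one_mul,
      Matrix.trace_diagonal] at h2
    exact_mod_cast h2
  have hle : ∀ i, l i ≤ 1 := fun i => by
    rw [← hs1]
    exact Finset.single_le_sum (fun i _ => hnn i) (Finset.mem_univ i)
  -- The eigenvalues lie in `[0, 1]`, and `∑ l = 1 ≤ ∑ l²` makes the sum of the nonnegative terms `l
  -- (1 - l)` vanish.
  have h0 : ∀ i, l i * (1 - l i) = 0 := by
    have hsum : ∑ i, l i * (1 - l i) = 0 := by
      refine le_antisymm ?_ (Finset.sum_nonneg fun i _ =>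
        mul_nonneg (hnn i) (sub_nonneg.mpr (hle i)))
      simp only [mul_sub, mul_one, Finset.sum_sub_distrib, hs1]
      linarith
    intro i
    exact (Finset.sum_eq_zero_iff_of_nonneg fun i _ =>
      mul_nonneg (hnn i) (sub_nonneg.mpr (hle i))).mp hsum i (Finset.mem_univ i)
  refine ⟨?_, ?_⟩
  · rw [hsq]
    conv_rhs => rw [hspec]
    congr 3
    ext i
    have := h0 i
    have : l i * l i = l i := by linarith
    exact_mod_cast this
  · obtain ⟨i₀, hi₀⟩ : ∃ i, l i ≠ 0 := by
      by_contra! hcon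
      simp [hcon] at hs1
    have hone : l i₀ = 1 := by
      have := (mul_eq_zero.mp (h0 i₀)).resolve_left hi₀
      linarith
    have hz : ∀ i, i ≠ i₀ → l i = 0 := by
      intro i hi
      have := Finset.add_sum_erase Finset.univ l (Finset.mem_univ i₀)
      rw [hs1, hone] at this
      have hz' : ∑ i ∈ Finset.univ.erase i₀, l i = 0 := by linarith
      exact (Finset.sum_eq_zero_iff_of_nonneg fun i _ => hnn i).mp hz' i (by simp [hi])
    refine ⟨fun k => U k i₀, ?_⟩
    conv_lhs => rw [hspec]
    ext a b
    rw [Matrix.mul_apply]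
    simp only [Matrix.mul_diagonal, Matrix.conjTranspose_apply, vecMulVec_apply, Pi.star_apply]
    rw [Finset.sum_eq_single i₀]
    · simp [hone]
    · intro i _ hi
      simp [hz i hi]
    · simp

end Matrix

namespace QuantumNetwork

/-! ### Tensor products of local operators -/

section Tensor

variable {V : Type*} [Fintype V] {α β γ : V → Type*}

theorem tensor_apply (A : ∀ v, Matrix (α v) (β v) ℂ) (x : ∀ v, α v) (y : ∀ v, β v) :
    tensor A x y = ∏ v, A v (x v) (y v) := rfl

theorem tensor_conjTranspose (A : ∀ v, Matrix (α v) (β v) ℂ) :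
    (tensor A)ᴴ = tensor fun v => (A v)ᴴ := by
  ext x y
  simp [tensor_apply, Matrix.conjTranspose_apply, star_prod]

theorem tensor_mul [DecidableEq V] [∀ v, Fintype (β v)] (A : ∀ v, Matrix (α v) (β v) ℂ)
    (B : ∀ v, Matrix (β v) (γ v) ℂ) :
    tensor A * tensor B = tensor fun v => A v * B v := by
  ext x y
  simp only [tensor_apply, Matrix.mul_apply, ← Finset.prod_mul_distrib]
  rw [Fintype.prod_sum]

theorem tensor_one [DecidableEq V] [∀ v, DecidableEq (α v)] [DecidableEq (∀ v, α v)] :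
    tensor (fun v => (1 : Matrix (α v) (α v) ℂ)) = 1 := by
  ext x y
  simp only [tensor_apply, Matrix.one_apply]
  by_cases h : x = y
  · simp [h]
  · rw [if_neg h]
    obtain ⟨v, hv⟩ := Function.ne_iff.mp h
    exact Finset.prod_eq_zero (Finset.mem_univ v) (if_neg hv)

theorem trace_tensor [DecidableEq V] [∀ v, Fintype (α v)] (A : ∀ v, Matrix (α v) (α v) ℂ) :
    (tensor A).trace = ∏ v, (A v).trace := by
  simp only [Matrix.trace, Matrix.diag_apply, tensor_apply]
  rw [Fintype.prod_sum]

theorem sum_tensor [DecidableEq V] {ι : V → Type*} [∀ v, Fintype (ι v)]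
    (A : ∀ v, ι v → Matrix (α v) (β v) ℂ) :
    ∑ i : (∀ v, ι v), tensor (fun v => A v (i v)) = tensor fun v => ∑ j, A v j := by
  ext x y
  simp only [Matrix.sum_apply, tensor_apply]
  rw [Fintype.prod_sum]

theorem tensor_posSemidef [DecidableEq V] [∀ v, Fintype (α v)] {A : ∀ v, Matrix (α v) (α v) ℂ}
    (h : ∀ v, (A v).PosSemidef) : (tensor A).PosSemidef := by
  choose B hB using fun v => (h v).exists_eq_mul_conjTranspose
  have : tensor A = tensor B * (tensor B)ᴴ := by
    rw [tensor_conjTranspose, tensor_mul]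
    exact congrArg tensor (funext hB)
  rw [this]
  exact Matrix.posSemidef_self_mul_conjTranspose _

theorem isDensity_tensor [DecidableEq V] [∀ v, Fintype (α v)] {A : ∀ v, Matrix (α v) (α v) ℂ}
    (h : ∀ v, IsDensity (A v)) : IsDensity (tensor A) :=
  ⟨tensor_posSemidef fun v => (h v).1, by simp [trace_tensor, (h _).2]⟩

end Tensor

/-! ### Local channels and their duals -/

section Channel

variable {V : Type*} [Fintype V] [DecidableEq V]

/-- The dual of a channel, acting on observables. -/
def Channel.dual {m k : Type*} [Fintype m] [DecidableEq m] [Fintype k] (C : Channel m k)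
    (M : Matrix k k ℂ) : Matrix m m ℂ :=
  ∑ i, (C.kraus i)ᴴ * M * C.kraus i

theorem Channel.dual_one {m k : Type*} [Fintype m] [DecidableEq m] [Fintype k] [DecidableEq k]
    (C : Channel m k) : C.dual 1 = 1 := by
  simp [Channel.dual, C.trace_preserving]

variable {α β : V → Type*} [∀ v, Fintype (α v)] [∀ v, DecidableEq (α v)] [∀ v, Fintype (β v)]

theorem applyLocal_posSemidef (C : ∀ v, Channel (α v) (β v))
    {X : Matrix (∀ v, α v) (∀ v, α v) ℂ} (hX : X.PosSemidef) :
    (applyLocal C X).PosSemidef :=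
  Matrix.posSemidef_sum _ fun _ _ => hX.mul_mul_conjTranspose_same _

/-- Product observables in the Heisenberg picture. -/
theorem trace_tensor_mul_applyLocal (C : ∀ v, Channel (α v) (β v))
    (M : ∀ v, Matrix (β v) (β v) ℂ) (X : Matrix (∀ v, α v) (∀ v, α v) ℂ) :
    (tensor M * applyLocal C X).trace = (tensor (fun v => (C v).dual (M v)) * X).trace := by
  have h : tensor (fun v => (C v).dual (M v)) =
      ∑ i : (∀ v, Fin (C v).rank), (tensor (fun v => (C v).kraus (i v)))ᴴ * tensor M *
        tensor (fun v => (C v).kraus (i v)) := by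
    simp only [tensor_conjTranspose, tensor_mul, Channel.dual]
    exact (sum_tensor fun v j => ((C v).kraus j)ᴴ * M v * (C v).kraus j).symm
  rw [h, applyLocal, Finset.mul_sum, Finset.sum_mul, Matrix.trace_sum, Matrix.trace_sum]
  refine Finset.sum_congr rfl fun i _ => ?_
  rw [← Matrix.mul_assoc, Matrix.trace_mul_comm]
  simp only [Matrix.mul_assoc]

theorem trace_applyLocal [∀ v, DecidableEq (β v)] (C : ∀ v, Channel (α v) (β v))
    (X : Matrix (∀ v, α v) (∀ v, α v) ℂ) : (applyLocal C X).trace = X.trace := by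
  have := trace_tensor_mul_applyLocal C (fun _ => 1) X
  simpa only [Channel.dual_one, tensor_one, Matrix.one_mul] using this

theorem isDensity_applyLocal [∀ v, DecidableEq (β v)] (C : ∀ v, Channel (α v) (β v))
    {X : Matrix (∀ v, α v) (∀ v, α v) ℂ} (hX : IsDensity X) : IsDensity (applyLocal C X) :=
  ⟨applyLocal_posSemidef C hX.1, by rw [trace_applyLocal, hX.2]⟩

end Channel

/-! ### Swap operators and the swap defect -/

section Swap

variable {W : Type*} [Fintype W] {d : ℕ}

theorem permOperator_mul (π σ : Equiv.Perm W) [DecidableEq W] :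
    permOperator d π * permOperator d σ = permOperator d (π * σ) := by
  ext x z
  rw [Matrix.mul_apply, Finset.sum_eq_single (x ∘ π)]
  · simp only [permOperator, Matrix.of_apply, if_true, one_mul, Function.comp_assoc,
      Equiv.Perm.coe_mul]
    congr
  · intro y _ hy
    simp [permOperator, Ne.symm hy]
  · simp

theorem permOperator_one [DecidableEq W] : permOperator d (1 : Equiv.Perm W) = 1 := by
  ext x y
  simp [permOperator, Matrix.one_apply]

theorem permOperator_conjTranspose (π : Equiv.Perm W) :
    (permOperator d π)ᴴ = permOperator d π⁻¹ := by
  ext x y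
  have : y ∘ π = x ↔ x ∘ ⇑π⁻¹ = y := by
    constructor <;> rintro rfl <;> ext <;> simp
  simp only [permOperator, Matrix.conjTranspose_apply, Matrix.of_apply, this]
  split_ifs <;> simp

variable [DecidableEq W]

theorem permOperator_swap_conjTranspose (x y : W) :
    (permOperator d (Equiv.swap x y))ᴴ = permOperator d (Equiv.swap x y) := by
  rw [permOperator_conjTranspose, Equiv.swap_inv]

theorem permOperator_swap_mul_self (x y : W) :
    permOperator d (Equiv.swap x y) * permOperator d (Equiv.swap x y) = 1 := by
  rw [permOperator_mul, Equiv.swap_mul_self, permOperator_one]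

/-- How far the state `γ` is from being an eigenvector, with eigenvalue the sign `ε`, of the swap
of the parties `x` and `y`. -/
def swapDefect (ε : ℝ) (γ : Operator W d) (x y : W) : ℝ :=
  1 - ε * (permOperator d (Equiv.swap x y) * γ).trace.re

/-- `Tr(aᴴ a γ)` is a squared seminorm. The right side minus the left is the sum of the squares of
`a - b`, `b - c` and `a - c`. -/
theorem weighted_norm_add_le {n : Type*} [Fintype n] {γ : Matrix n n ℂ} (hγ : γ.PosSemidef)
    (a b c : Matrix n n ℂ) :
    (((a + b + c)ᴴ * (a + b + c)) * γ).trace.re ≤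
      3 * ((aᴴ * a * γ).trace.re + (bᴴ * b * γ).trace.re + (cᴴ * c * γ).trace.re) := by
  have h : ∀ e : Matrix n n ℂ, 0 ≤ (eᴴ * e * γ).trace.re := fun e =>
    (Complex.nonneg_iff.mp
      ((Matrix.posSemidef_conjTranspose_mul_self e).trace_mul_nonneg hγ)).1
  have h1 := h (a - b)
  have h2 := h (b - c)
  have h3 := h (a - c)
  simp only [Matrix.conjTranspose_sub, Matrix.conjTranspose_add, Matrix.sub_mul, Matrix.mul_sub,
    Matrix.add_mul, Matrix.mul_add, Matrix.trace_sub, Matrix.trace_add, Complex.sub_re,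
    Complex.add_re] at h1 h2 h3 ⊢
  linarith

/-- A swap `F` is Hermitian and squares to `1`, so `(1 - εF)ᴴ(1 - εF) = 2 - 2εF`. This makes the
defect a squared seminorm. -/
theorem weighted_norm_one_sub_swap {ε : ℝ} (hε : ε * ε = 1) {γ : Operator W d}
    (h1 : γ.trace = 1) (x y : W) :
    (((1 - ε • permOperator d (Equiv.swap x y))ᴴ * (1 - ε • permOperator d (Equiv.swap x y))) *
      γ).trace.re = 2 * swapDefect ε γ x y := by
  have : ((1 - ε • permOperator d (Equiv.swap x y))ᴴ *
      (1 - ε • permOperator d (Equiv.swap x y)) : Operator W d) =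
      1 + 1 - (ε + ε) • permOperator d (Equiv.swap x y) := by
    rw [Matrix.conjTranspose_sub, Matrix.conjTranspose_one, Matrix.conjTranspose_smul,
      permOperator_swap_conjTranspose, star_trivial, Matrix.sub_mul, Matrix.mul_sub,
      Matrix.mul_sub, Matrix.smul_mul, Matrix.smul_mul, Matrix.mul_smul _ ε,
      Matrix.mul_smul _ ε,
      permOperator_swap_mul_self, smul_smul, hε, add_smul]
    simp only [Matrix.one_mul, Matrix.mul_one, one_smul]
    abel
  rw [this, Matrix.sub_mul, Matrix.add_mul, Matrix.one_mul, Matrix.smul_mul, Matrix.trace_sub,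
    Matrix.trace_add, Matrix.trace_smul, h1]
  simp [swapDefect]
  ring

theorem swapDefect_nonneg {ε : ℝ} (hε : ε * ε = 1) {γ : Operator W d} (hγ : IsDensity γ)
    (x y : W) : 0 ≤ swapDefect ε γ x y := by
  have h := (Complex.nonneg_iff.mp ((Matrix.posSemidef_conjTranspose_mul_self
    (1 - ε • permOperator d (Equiv.swap x y))).trace_mul_nonneg hγ.1)).1
  rw [weighted_norm_one_sub_swap hε hγ.2] at h
  linarith

/-- The swap of `x` and `z` is the conjugate `F H F` of the swap `H` of `y` and `z` by the swap `F`
of `x` and `y`. Hence `1 - εFHF` telescopes into three terms, each a unitary times `1 - εF` (twice)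
or `1 - εH` (once). -/
theorem swapDefect_trans {ε : ℝ} (hε : ε * ε = 1) {γ : Operator W d} (hγ : IsDensity γ)
    {x y z : W} (hyz : y ≠ z) (hxz : x ≠ z) :
    swapDefect ε γ x z ≤ 6 * swapDefect ε γ x y + 3 * swapDefect ε γ y z := by
  set F := permOperator d (Equiv.swap x y) with hF
  set H := permOperator d (Equiv.swap y z) with hH
  have hFF : F * F = 1 := permOperator_swap_mul_self x y
  have hHH : H * H = 1 := permOperator_swap_mul_self y z
  have hFt : Fᴴ = F := permOperator_swap_conjTranspose x y
  have hHt : Hᴴ = H := permOperator_swap_conjTranspose y z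
  have hxz' : permOperator d (Equiv.swap x z) = F * H * F := by
    rw [hF, hH, permOperator_mul, permOperator_mul]
    congr 1
    rw [Equiv.swap_comm x y, Equiv.swap_comm y z]
    exact (Equiv.swap_mul_swap_mul_swap hyz.symm hxz.symm).symm
  have hdec : (1 - ε • permOperator d (Equiv.swap x z) : Operator W d) =
      (1 - ε • F) + (ε • F) * (1 - ε • H) + (F * H) * (1 - ε • F) := by
    rw [hxz', Matrix.mul_sub, Matrix.mul_sub, Matrix.smul_mul, Matrix.smul_mul, Matrix.mul_smul,
      Matrix.mul_smul, smul_smul, hε, one_smul, Matrix.mul_one, Matrix.mul_one]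
    abel
  have hU1 : (ε • F)ᴴ * (ε • F) = 1 := by
    rw [Matrix.conjTranspose_smul, hFt, star_trivial, Matrix.smul_mul, Matrix.mul_smul, hFF,
      smul_smul, hε, one_smul]
  have hU2 : (F * H)ᴴ * (F * H) = 1 := by
    rw [Matrix.conjTranspose_mul, hFt, hHt, Matrix.mul_assoc, ← Matrix.mul_assoc F, hFF,
      Matrix.one_mul, hHH]
  have hU : ∀ U A : Operator W d, Uᴴ * U = 1 → (U * A)ᴴ * (U * A) = Aᴴ * A := by
    intro U A h
    rw [Matrix.conjTranspose_mul, Matrix.mul_assoc, ← Matrix.mul_assoc Uᴴ, h, Matrix.one_mul]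
  have h := weighted_norm_add_le hγ.1 (1 - ε • F) ((ε • F) * (1 - ε • H))
    ((F * H) * (1 - ε • F))
  rw [← hdec, hU _ _ hU1, hU _ _ hU2, weighted_norm_one_sub_swap hε hγ.2,
    weighted_norm_one_sub_swap hε hγ.2, weighted_norm_one_sub_swap hε hγ.2] at h
  linarith

/-- The constant comes from `6 * 9 ^ k + 3 ≤ 9 ^ (k + 1)`. -/
theorem swapDefect_chain {ε : ℝ} (hε : ε * ε = 1) {γ : Operator W d} (hγ : IsDensity γ)
    (x : ℕ → W) (D : ℝ) (k : ℕ) (hx : Set.InjOn x (Set.Iic (k + 1)))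
    (h : ∀ i ≤ k, swapDefect ε γ (x i) (x (i + 1)) ≤ D) :
    swapDefect ε γ (x 0) (x (k + 1)) ≤ 9 ^ k * D := by
  induction k with
  | zero => simpa using h 0 le_rfl
  | succ k ih =>
    have h0 := ih (hx.mono (Set.Iic_subset_Iic.mpr (by omega))) fun i hi => h i (by omega)
    have hD : 0 ≤ D := (swapDefect_nonneg hε hγ _ _).trans (h 0 (by omega))
    have hne : ∀ i < k + 1 + 1, x i ≠ x (k + 1 + 1) := fun i hi heq => by
      have := hx (Set.mem_Iic.mpr hi.le) (Set.mem_Iic.mpr le_rfl) heq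
      omega
    have h1 := swapDefect_trans hε hγ (hne (k + 1) (by omega)) (hne 0 (by omega))
    have h2 := h (k + 1) le_rfl
    have h3 : (1 : ℝ) ≤ 9 ^ k := one_le_pow₀ (by norm_num)
    have h4 : D ≤ 9 ^ k * D := le_mul_of_one_le_left hD h3
    rw [pow_succ]
    linarith

/-- The observable `A` of the party `x` together with the observable `B` of the party `y`. -/
def pairOperator (x y : W) (A B : Matrix (Fin d) (Fin d) ℂ) : Operator W d :=
  tensor fun u => if u = x then A else if u = y then B else 1

/-- The observable `A` of the party `x`. -/
def localOperator (x : W) (A : Matrix (Fin d) (Fin d) ℂ) : Operator W d :=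
  tensor fun u => if u = x then A else 1

theorem pairOperator_apply {x y : W} (hxy : x ≠ y) (A B : Matrix (Fin d) (Fin d) ℂ)
    (a b : W → Fin d) : pairOperator x y A B a b =
      A (a x) (b x) * B (a y) (b y) * if ∀ u, u ≠ x → u ≠ y → a u = b u then 1 else 0 := by
  rw [pairOperator, tensor_apply, ← Finset.mul_prod_erase _ _ (Finset.mem_univ x), if_pos rfl,
    ← Finset.mul_prod_erase _ _ (Finset.mem_erase.mpr ⟨hxy.symm, Finset.mem_univ y⟩),
    if_neg hxy.symm, if_pos rfl, mul_assoc]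
  congr 2
  split_ifs with h
  · refine Finset.prod_eq_one fun u hu => ?_
    simp only [Finset.mem_erase] at hu
    rw [if_neg hu.2.1, if_neg hu.1, h u hu.2.1 hu.1, Matrix.one_apply_eq]
  · push Not at h
    obtain ⟨u, hux, huy, hu⟩ := h
    refine Finset.prod_eq_zero (i := u) (by simp [hux, huy]) ?_
    simp [hux, huy, hu]

/-- Reduces swap expectations to those of product observables of two parties, which are what the
inflation controls. -/
theorem permOperator_swap_eq_sum {x y : W} (hxy : x ≠ y) :
    permOperator d (Equiv.swap x y) =
      ∑ i, ∑ j, pairOperator x y (Matrix.single i j 1) (Matrix.single j i 1) := by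
  ext a b
  have hiff : a ∘ Equiv.swap x y = b ↔
      (a x = b y ∧ a y = b x) ∧ ∀ u, u ≠ x → u ≠ y → a u = b u := by
    constructor
    · rintro rfl
      refine ⟨by simp, fun u hx hy => ?_⟩
      simp [Equiv.swap_apply_of_ne_of_ne hx hy]
    · rintro ⟨⟨h1, h2⟩, h3⟩
      ext u
      by_cases hx : u = x
      · subst hx; simp [h2]
      by_cases hy : u = y
      · subst hy; simp [h1]
      simp [Equiv.swap_apply_of_ne_of_ne hx hy, h3 u hx hy]
  simp only [Matrix.sum_apply, pairOperator_apply hxy]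
  rw [Finset.sum_eq_single (a x), Finset.sum_eq_single (b x)]
  · simp only [permOperator, Matrix.of_apply, hiff, Matrix.single_apply, and_self,
      if_true, one_mul]
    by_cases h1 : a x = b y <;> by_cases h2 : a y = b x <;> simp [h1, h2, eq_comm]
  · intro j _ hj
    simp [Matrix.single_apply, hj]
  · simp
  · intro i _ hi
    simp [Matrix.single_apply, hi]
  · simp

end Swap

/-- Schur product theorem, iterated; the empty product is the all-ones matrix. -/
theorem posSemidef_prod {n ι : Type*} [Fintype n] (s : Finset ι) (A : ι → Matrix n n ℂ)
    (h : ∀ i ∈ s, (A i).PosSemidef) :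
    (Matrix.of fun a b => ∏ i ∈ s, A i a b : Matrix n n ℂ).PosSemidef := by
  classical
  induction s using Finset.induction_on with
  | empty =>
    convert Matrix.posSemidef_vecMulVec_self_star (fun _ : n => (1 : ℂ)) using 1
    ext a b
    simp [Matrix.vecMulVec_apply]
  | insert i s hi ih =>
    have heq : (Matrix.of fun a b => ∏ j ∈ insert i s, A j a b : Matrix n n ℂ) =
        (A i).hadamard (Matrix.of fun a b => ∏ j ∈ s, A j a b) := by
      ext a b
      simp [Finset.prod_insert hi, Matrix.hadamard_apply]
    rw [heq]
    exact (h i (Finset.mem_insert_self i s)).hadamard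
      (ih fun j hj => h j (Finset.mem_insert_of_mem hj))

/-- The partial trace over all the parties but `v`. -/
def marginal {V : Type*} [Fintype V] [DecidableEq V] {d : ℕ} (ω : Operator V d) (v : V) :
    Matrix (Fin d) (Fin d) ℂ :=
  Matrix.of fun i j => (localOperator v (Matrix.single j i 1) * ω).trace

/-! ### Inflations and regrouping of particles -/

section Rewire

variable {V : Type*} {G : Hypergraph V} {D : Set V → V → ℕ}

/-- Regrouping of the particles in two copies of a network. -/
def rewire (r : V → Set V → Bool) :
    (Bool → ∀ v, PartyBasis G D v) ≃ (∀ w : V × Bool, PartyBasis G D w.1) where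
  toFun a w := fun e => a (w.2 ^^ r w.1 e) w.1 e
  invFun a c v := fun e => a (v, c ^^ r v e) e
  left_inv a := by
    funext c v
    refine funext fun e : {e : Set V // e ∈ G.edgeSet ∧ v ∈ e} => ?_
    simp
  right_inv a := by
    funext ⟨v, b⟩
    refine funext fun e : {e : Set V // e ∈ G.edgeSet ∧ v ∈ e} => ?_
    have hb : ((b ^^ r v e) ^^ r v e) = b := by simp
    have h : ∀ c, c = b → (a (v, c) : PartyBasis G D v) e = (a (v, b) : PartyBasis G D v) e := by
      rintro _ rfl
      rfl
    exact h _ hb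

theorem rewire_apply (r : V → Set V → Bool) (a : Bool → ∀ v, PartyBasis G D v) (v : V) (c : Bool)
    (e : {e : Set V // e ∈ G.edgeSet ∧ v ∈ e}) :
    rewire r a (v, c) e = a (c ^^ r v e) v e := rfl

variable [Fintype V]
  (τ : ∀ e : G.edgeSet, Matrix (SourceBasis D (e : Set V)) (SourceBasis D (e : Set V)) ℂ)

/-- The joint state of two copies of every source, shared by two copies of every party: the copy
`b` of the party `v` is connected to the copy `b ^^ s v e` of the source `e`. -/
def inflation (s : V → Set V → Bool) :
    Matrix (∀ w : V × Bool, PartyBasis G D w.1) (∀ w : V × Bool, PartyBasis G D w.1) ℂ :=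
  Matrix.of fun a b => ∏ e : G.edgeSet, ∏ c : Bool,
    τ e (fun v => a (v, c ^^ s v e) ⟨e, e.2, v.2⟩) (fun v => b (v, c ^^ s v e) ⟨e, e.2, v.2⟩)

/-- Undoing the crossings leaves two separate copies of the network. The freedom `t` exchanges the
two copies of a source, which does not change their product. -/
theorem inflation_rewire (s : V → Set V → Bool) (t : Set V → Bool)
    (a b : Bool → ∀ v, PartyBasis G D v) :
    inflation τ s (rewire (fun v e => s v e ^^ t e) a) (rewire (fun v e => s v e ^^ t e) b) =
      ∏ c, distribute G D τ (a c) (b c) := by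
  simp only [inflation, distribute, Matrix.of_apply]
  have hx : ∀ (c : Bool) (e : Set V) (v : V),
      ((c ^^ s v e) ^^ (s v e ^^ t e)) = (c ^^ t e) := by
    intro c e v
    cases c <;> cases s v e <;> cases t e <;> rfl
  conv_rhs => rw [Finset.prod_comm]
  refine Finset.prod_congr rfl fun e _ => ?_
  have : ∀ c : Bool, τ e
      (fun v => rewire (fun v e => s v e ^^ t e) a (v, c ^^ s v e) ⟨e, e.2, v.2⟩)
      (fun v => rewire (fun v e => s v e ^^ t e) b (v, c ^^ s v e) ⟨e, e.2, v.2⟩) =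
      τ e (fun v => a (c ^^ t e) v ⟨e, e.2, v.2⟩) (fun v => b (c ^^ t e) v ⟨e, e.2, v.2⟩) := by
    intro c
    have hf : ∀ a : Bool → ∀ v, PartyBasis G D v,
        (fun v : (e : Set V) => rewire (fun v e => s v e ^^ t e) a ((v : V), c ^^ s v e)
          ⟨e, e.2, v.2⟩) = fun v : (e : Set V) => a (c ^^ t e) v ⟨e, e.2, v.2⟩ := by
      intro a
      funext v
      rw [rewire_apply, hx]
    exact congrArg₂ (τ e) (hf a) (hf b)
  simp only [this]
  cases t e <;> simp [mul_comm]

/-- A party measured trivially may have its particles split between the copies, since an identity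
only compares indices. Any other party must be regrouped as a whole, by `q v`. -/
theorem tensor_rewire (r : V → Set V → Bool) (q : V → Bool)
    (M M' : ∀ w : V × Bool, Matrix (PartyBasis G D w.1) (PartyBasis G D w.1) ℂ)
    (h : ∀ v, (∀ b, M (v, b) = 1 ∧ M' (v, b) = 1) ∨
      ((∀ e ∈ G.edgeSet, v ∈ e → r v e = q v) ∧ ∀ b, M' (v, b) = M (v, b ^^ q v)))
    (a b : Bool → ∀ v, PartyBasis G D v) :
    tensor M (rewire r a) (rewire r b) = ∏ c, tensor (fun v => M' (v, c)) (a c) (b c) := by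
  simp only [tensor_apply]
  rw [Fintype.prod_prod_type]
  conv_rhs => rw [Finset.prod_comm]
  refine Finset.prod_congr rfl fun v _ => ?_
  rcases h v with h | ⟨h1, h2⟩
  · simp only [(h _).1, (h _).2, Matrix.one_apply, Finset.prod_boole]
    have : (∀ c ∈ Finset.univ, rewire r a (v, c) = rewire r b (v, c)) ↔
        ∀ c ∈ Finset.univ, a c v = b c v := by
      simp only [Finset.mem_univ, true_implies]
      constructor
      · intro h c
        refine funext fun e : {e : Set V // e ∈ G.edgeSet ∧ v ∈ e} => ?_
        have := congrFun (h (c ^^ r v e)) e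
        rw [rewire_apply, rewire_apply] at this
        simpa using this
      · intro h c
        refine funext fun e : {e : Set V // e ∈ G.edgeSet ∧ v ∈ e} => ?_
        exact congrFun (h _) e
    by_cases hc : ∀ c ∈ Finset.univ, a c v = b c v
    · rw [if_pos (this.mpr hc), if_pos hc]
    · rw [if_neg (mt this.mp hc), if_neg hc]
  · have hr : ∀ (a : Bool → ∀ v, PartyBasis G D v) (c : Bool),
        rewire r a (v, c) = a (c ^^ q v) v := by
      intro a c
      refine funext fun e : {e : Set V // e ∈ G.edgeSet ∧ v ∈ e} => ?_
      rw [rewire_apply, h1 e.1 e.2.1 e.2.2]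
    have h20 := h2 false
    have h21 := h2 true
    simp only [hr, Fintype.prod_bool]
    cases hq : q v <;> rw [hq] at h20 h21
    · change M' (v, false) = M (v, false) at h20
      change M' (v, true) = M (v, true) at h21
      simp [h20, h21]
    · change M' (v, false) = M (v, true) at h20
      change M' (v, true) = M (v, false) at h21
      simp [h20, h21, mul_comm]

end Rewire

/-! ### States prepared from networks and inflations -/

section Sources

variable {V : Type*} [Fintype V] [DecidableEq V] {G : Hypergraph V} {D : Set V → V → ℕ}
  (τ : ∀ e : G.edgeSet, Matrix (SourceBasis D (e : Set V)) (SourceBasis D (e : Set V)) ℂ)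

/-- Regrouping of the particles of a network by source instead of by party. -/
def particlesEquiv (G : Hypergraph V) (D : Set V → V → ℕ) :
    (∀ v, PartyBasis G D v) ≃ (∀ e : G.edgeSet, SourceBasis D (e : Set V)) where
  toFun a e := fun v => a v ⟨e, e.2, v.2⟩
  invFun f v := fun e => f ⟨e.1, e.2.1⟩ ⟨v, e.2.2⟩
  left_inv _ := rfl
  right_inv _ := rfl

theorem isDensity_distribute (hτ : ∀ e, IsDensity (τ e)) : IsDensity (distribute G D τ) := by
  classical
  constructor
  · exact posSemidef_prod Finset.univ
      (fun e => (τ e).submatrix (fun a => particlesEquiv G D a e) fun a => particlesEquiv G D a e)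
      fun e _ => (hτ e).1.submatrix _
  · have h : (distribute G D τ).trace = ∏ e, (τ e).trace := by
      simp only [Matrix.trace, Matrix.diag_apply]
      rw [Fintype.prod_sum, ← (particlesEquiv G D).sum_comp]
      rfl
    rw [h, Finset.prod_eq_one fun e _ => (hτ e).2]

theorem inflation_posSemidef (hτ : ∀ e, IsDensity (τ e)) (s : V → Set V → Bool) :
    (inflation τ s).PosSemidef := by
  classical
  exact posSemidef_prod Finset.univ _ fun e _ => posSemidef_prod Finset.univ
    (fun c => (τ e).submatrix
      (fun a : (∀ w : V × Bool, PartyBasis G D w.1) => fun v => a (v, c ^^ s v e) ⟨e, e.2, v.2⟩)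
      fun a : (∀ w : V × Bool, PartyBasis G D w.1) => fun v => a (v, c ^^ s v e) ⟨e, e.2, v.2⟩)
    fun c _ => (hτ e).1.submatrix _

/-- If relabelling the copies of sources by `t` and of parties by `q` uncrosses the wires of every
measured party, the expectation factors over two independent copies of the network. -/
theorem trace_tensor_mul_inflation (s : V → Set V → Bool) (t : Set V → Bool) (q : V → Bool)
    (M M' : ∀ w : V × Bool, Matrix (PartyBasis G D w.1) (PartyBasis G D w.1) ℂ)
    (h : ∀ v, (∀ b, M (v, b) = 1 ∧ M' (v, b) = 1) ∨
      ((∀ e ∈ G.edgeSet, v ∈ e → s v e = (t e ^^ q v)) ∧ ∀ b, M' (v, b) = M (v, b ^^ q v))) :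
    (tensor M * inflation τ s).trace =
      ∏ c, (tensor (fun v => M' (v, c)) * distribute G D τ).trace := by
  have h' : ∀ v, (∀ b, M (v, b) = 1 ∧ M' (v, b) = 1) ∨
      ((∀ e ∈ G.edgeSet, v ∈ e → (s v e ^^ t e) = q v) ∧
        ∀ b, M' (v, b) = M (v, b ^^ q v)) := by
    intro v
    refine (h v).imp_right fun h => ⟨fun e he hv => ?_, h.2⟩
    rw [h.1 e he hv]
    cases t e <;> simp
  simp only [Matrix.trace, Matrix.diag_apply, Matrix.mul_apply]
  rw [Fintype.prod_sum, ← (rewire fun v e => s v e ^^ t e).sum_comp]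
  refine Finset.sum_congr rfl fun a _ => ?_
  rw [Fintype.prod_sum, ← (rewire fun v e => s v e ^^ t e).sum_comp]
  refine Finset.sum_congr rfl fun b _ => ?_
  rw [inflation_rewire, tensor_rewire _ q M M' h', Finset.prod_mul_distrib]

variable {d : ℕ} (C : ∀ v, Channel (PartyBasis G D v) (Fin d))

/-- The state prepared by local channels from the inflation of a network. -/
def inflatedState (s : V → Set V → Bool) : Operator (V × Bool) d :=
  applyLocal (α := fun w : V × Bool => PartyBasis G D w.1) (fun w : V × Bool => C w.1)
    (inflation τ s)

theorem trace_tensor_mul_inflatedState (s : V → Set V → Bool) (t : Set V → Bool) (q : V → Bool)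
    (N N' : V × Bool → Matrix (Fin d) (Fin d) ℂ)
    (h : ∀ v, (∀ b, N (v, b) = 1 ∧ N' (v, b) = 1) ∨
      ((∀ e ∈ G.edgeSet, v ∈ e → s v e = (t e ^^ q v)) ∧ ∀ b, N' (v, b) = N (v, b ^^ q v))) :
    (tensor N * inflatedState τ C s).trace =
      ∏ c, (tensor (fun v => N' (v, c)) * applyLocal C (distribute G D τ)).trace := by
  rw [inflatedState, trace_tensor_mul_applyLocal, trace_tensor_mul_inflation τ s t q _
    (fun w => (C w.1).dual (N' w))]
  · simp only [trace_tensor_mul_applyLocal]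
  · intro v
    refine (h v).imp (fun h b => ?_) fun h => ⟨h.1, fun b => ?_⟩
    · simp only [(h b).1, (h b).2, Channel.dual_one, and_self]
    · simp only [h.2]

theorem isDensity_inflatedState (hτ : ∀ e, IsDensity (τ e)) (s : V → Set V → Bool) :
    IsDensity (inflatedState τ C s) := by
  refine ⟨applyLocal_posSemidef _ (inflation_posSemidef τ hτ s), ?_⟩
  have h := trace_tensor_mul_inflatedState τ C s (fun _ => false) (fun _ => false)
    (fun _ => 1) (fun _ => 1) fun v => Or.inl fun b => ⟨rfl, rfl⟩
  rw [tensor_one, tensor_one] at h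
  simpa [(isDensity_applyLocal C (isDensity_distribute τ hτ)).2] using h

/-- Two parties of an inflation that see their common sources as in the original network share the
original bipartite state. -/
theorem trace_pairOperator_mul_inflatedState (hτ : ∀ e, IsDensity (τ e)) (s : V → Set V → Bool)
    {x y : V × Bool} (hxy : x.1 ≠ y.1)
    (h : ∀ e ∈ G.edgeSet, x.1 ∈ e → y.1 ∈ e → (x.2 ^^ s x.1 e) = (y.2 ^^ s y.1 e))
    (A B : Matrix (Fin d) (Fin d) ℂ) :
    (pairOperator x y A B * inflatedState τ C s).trace =
      (pairOperator x.1 y.1 A B * applyLocal C (distribute G D τ)).trace := by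
  classical
  -- The labels `t` and `q` move both observables to the copy `false`; `h` makes `t` consistent on
  -- common sources. The copy `true` carries only identities and contributes the factor `1`.
  rw [pairOperator, trace_tensor_mul_inflatedState τ C s
    (fun e => if x.1 ∈ e then x.2 ^^ s x.1 e else y.2 ^^ s y.1 e)
    (fun v => if v = x.1 then x.2 else if v = y.1 then y.2 else false) _
    (fun w => if w.2 then 1 else if w.1 = x.1 then A else if w.1 = y.1 then B else 1)]
  · rw [Fintype.prod_bool]
    simp only [if_true, Bool.false_eq_true, if_false]
    rw [tensor_one, Matrix.one_mul, (isDensity_applyLocal C (isDensity_distribute τ hτ)).2,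
      one_mul]
    rfl
  · obtain ⟨x, b⟩ := x
    obtain ⟨y, b'⟩ := y
    intro v
    by_cases hx : v = x
    · subst hx
      right
      refine ⟨fun e he hv => ?_, fun c => ?_⟩
      · cases b <;> simp [hv]
      · cases b <;> cases c <;> simp [hxy]
    by_cases hy : v = y
    · subst hy
      right
      refine ⟨fun e he hv => ?_, fun c => ?_⟩
      · have := fun hx => h e he hx hv
        by_cases hxe : x ∈ e
        · simp only at this
          simp only [hxe, if_true, hx, if_false, this hxe]
          cases b' <;> simp
        · simp only [hxe, hx, if_true, if_false]
          cases b' <;> simp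
      · cases b' <;> cases c <;> simp [hx]
    · left
      intro c
      simp [hx, hy]

theorem swapDefect_inflatedState (ε : ℝ) (hτ : ∀ e, IsDensity (τ e)) (s : V → Set V → Bool)
    {x y : V × Bool} (hxy : x.1 ≠ y.1)
    (h : ∀ e ∈ G.edgeSet, x.1 ∈ e → y.1 ∈ e → (x.2 ^^ s x.1 e) = (y.2 ^^ s y.1 e)) :
    swapDefect ε (inflatedState τ C s) x y =
      swapDefect ε (applyLocal C (distribute G D τ)) x.1 y.1 := by
  have hxy' : x ≠ y := fun h => hxy (congrArg Prod.fst h)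
  simp only [swapDefect, permOperator_swap_eq_sum hxy, permOperator_swap_eq_sum hxy',
    Finset.sum_mul, Matrix.trace_sum, trace_pairOperator_mul_inflatedState τ C hτ s hxy h]

/-- The two copies of a party of an inflation that are connected to different copies of all the
sources are independent. -/
theorem swapDefect_inflatedState_copies (ε : ℝ) (s : V → Set V → Bool) (v : V)
    (h : ∀ e ∈ G.edgeSet, v ∈ e → s v e = false) :
    swapDefect ε (inflatedState τ C s) (v, false) (v, true) =
      1 - ε * (marginal (applyLocal C (distribute G D τ)) v *
        marginal (applyLocal C (distribute G D τ)) v).trace.re := by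
  have hne : ((v, false) : V × Bool) ≠ (v, true) := by simp
  have key : ∀ A B, (pairOperator (v, false) (v, true) A B * inflatedState τ C s).trace =
      (localOperator v A * applyLocal C (distribute G D τ)).trace *
        (localOperator v B * applyLocal C (distribute G D τ)).trace := by
    intro A B
    rw [pairOperator, trace_tensor_mul_inflatedState τ C s (fun _ => false) (fun _ => false) _
      (fun w => if w = (v, false) then A else if w = (v, true) then B else 1)]
    · rw [Fintype.prod_bool, mul_comm]
      simp [localOperator]
    · intro u
      by_cases hu : u = v
      · subst hu
        exact Or.inr ⟨fun e he hv => by simp [h e he hv], fun c => by simp⟩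
      · left
        simp [hu]
  simp only [swapDefect, permOperator_swap_eq_sum hne, Finset.sum_mul, Matrix.trace_sum, key]
  congr 3
  rw [Matrix.trace]
  simp only [Matrix.diag_apply, Matrix.mul_apply]
  refine Finset.sum_congr rfl fun i _ => Finset.sum_congr rfl fun j _ => ?_
  simp [marginal, mul_comm]

end Sources

/-! ### Total defect and the purity bound -/

variable {V : Type*} [Fintype V] [DecidableEq V]

/-- The sum of the swap defects of all pairs of distinct parties. -/
def totalDefect {d : ℕ} (ε : ℝ) (γ : Operator V d) : ℝ :=
  ∑ p ∈ (Finset.univ : Finset V).offDiag, swapDefect ε γ p.1 p.2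

theorem swapDefect_le_totalDefect {d : ℕ} {ε : ℝ} (hε : ε * ε = 1) {γ : Operator V d}
    (hγ : IsDensity γ) {x y : V} (h : x ≠ y) : swapDefect ε γ x y ≤ totalDefect ε γ := by
  have hmem : (x, y) ∈ (Finset.univ : Finset V).offDiag := by simpa using h
  have h0 : ∀ p ∈ (Finset.univ : Finset V).offDiag, 0 ≤ swapDefect ε γ p.1 p.2 :=
    fun p _ => swapDefect_nonneg hε hγ p.1 p.2
  have h1 := Finset.single_le_sum h0 hmem
  rw [totalDefect]
  exact h1

theorem totalDefect_nonneg {d : ℕ} {ε : ℝ} (hε : ε * ε = 1) {γ : Operator V d}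
    (hγ : IsDensity γ) : 0 ≤ totalDefect ε γ :=
  Finset.sum_nonneg fun p _ => swapDefect_nonneg hε hγ p.1 p.2

/-- In a network, near-symmetry of a state that is prepared without shared randomness forces its
one-party marginals to be nearly pure; the anti-symmetric version (`ε = -1`) bounds the total defect
away from zero. -/
theorem one_sub_marginal_sq_le (hV : 2 ≤ Fintype.card V) {G : Hypergraph V} (hG : IsNetwork G)
    {D : Set V → V → ℕ}
    {τ : ∀ e : G.edgeSet, Matrix (SourceBasis D (e : Set V)) (SourceBasis D (e : Set V)) ℂ}
    (hτ : ∀ e, IsDensity (τ e)) {d : ℕ} (C : ∀ v, Channel (PartyBasis G D v) (Fin d))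
    {ε : ℝ} (hε : ε * ε = 1) (v₀ : V) :
    1 - ε * (marginal (applyLocal C (distribute G D τ)) v₀ *
        marginal (applyLocal C (distribute G D τ)) v₀).trace.re ≤
      9 ^ (Fintype.card V - 1) * totalDefect ε (applyLocal C (distribute G D τ)) := by
  classical
  have hω := isDensity_applyLocal C (isDensity_distribute τ hτ)
  set ω := applyLocal C (distribute G D τ)
  obtain ⟨k, hk⟩ : ∃ k, Fintype.card V = k + 1 :=
    Nat.exists_eq_succ_of_ne_zero (Fintype.card_pos_iff.mpr ⟨v₀⟩).ne'
  obtain ⟨φ, hφ⟩ : ∃ φ : V ≃ Fin (k + 1), φ v₀ = 0 := by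
    let φ := Fintype.equivFinOfCardEq hk
    exact ⟨φ.trans (Equiv.swap (φ v₀) 0), by simp⟩
  have hφ' : φ.symm 0 = v₀ := by rw [← hφ, Equiv.symm_apply_apply]
  -- The wires of a source at `v₀` are crossed for all parties that come after one the source
  -- misses. The chain `x` below visits the copies `false` in order and closes at `(v₀, true)`.
  let s : V → Set V → Bool := fun v e => decide (v₀ ∈ e ∧ ∃ u ∉ e, φ u < φ v)
  have hs₀ : ∀ e, s v₀ e = false := by simp [s, hφ]
  let x : ℕ → V × Bool := fun i => if h : i < k + 1 then (φ.symm ⟨i, h⟩, false) else (v₀, true)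
  have hx : ∀ i (h : i < k + 1), x i = (φ.symm ⟨i, h⟩, false) := fun i h => dif_pos h
  have hx0 : x 0 = (v₀, false) := by rw [hx 0 (by omega)]; exact congrArg (·, false) hφ'
  have hxk : x (k + 1) = (v₀, true) := dif_neg (by omega)
  have hγ := isDensity_inflatedState τ C hτ s
  rw [← swapDefect_inflatedState_copies τ C ε s v₀ fun e _ _ => hs₀ e, hk, Nat.add_sub_cancel,
    ← hx0, ← hxk]
  have hD := totalDefect_nonneg hε hω
  apply swapDefect_chain hε hγ x _ k
  · intro i hi j hj hij
    simp only [Set.mem_Iic] at hi hj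
    rcases hi.lt_or_eq with hi | rfl <;> rcases hj.lt_or_eq with hj | rfl
    · rw [hx i hi, hx j hj] at hij
      simpa using hij
    · rw [hx i hi, hxk] at hij
      simp at hij
    · rw [hx j hj, hxk] at hij
      simp at hij
    · rfl
  · intro i hi
    rcases hi.lt_or_eq with hi | rfl
    · rw [hx i (by omega), hx (i + 1) (by omega)]
      have hne : φ.symm ⟨i, by omega⟩ ≠ φ.symm ⟨i + 1, by omega⟩ := by simp
      rw [swapDefect_inflatedState τ C ε hτ s hne]
      · exact swapDefect_le_totalDefect hε hω hne
      · intro e _ h1 h2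
        -- The `i`-th party belongs to `e`, so no missed party lies between the two thresholds and
        -- the crossing is unchanged.
        have : ∀ u ∉ e, (φ u < ⟨i, by omega⟩ ↔ φ u < ⟨i + 1, by omega⟩) := by
          intro u hu
          have hui : φ u ≠ ⟨i, by omega⟩ := by
            rintro h
            rw [← h, Equiv.symm_apply_apply] at h1
            exact hu h1
          have hui' : (φ u : ℕ) ≠ i := fun h => hui (Fin.ext h)
          simp only [Fin.lt_def]
          omega
        simp only [s, Equiv.apply_symm_apply, Bool.false_xor, decide_eq_decide]
        exact and_congr_right fun _ => exists_congr fun u => and_congr_right fun hu => this u hu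
    · rw [hx i (by omega), hxk]
      have hne : φ.symm ⟨i, by omega⟩ ≠ v₀ := by
        rw [← hφ']
        simp [Fin.ext_iff]
        omega
      rw [swapDefect_inflatedState τ C ε hτ s hne]
      · exact swapDefect_le_totalDefect hε hω hne
      · intro e he h1 h2
        -- Here the network hypothesis enters: `e` misses a party, necessarily before the last one,
        -- so the last party is wired to the copy `true`, as is `(v₀, true)`.
        obtain ⟨u, hu⟩ := (Set.ne_univ_iff_exists_notMem e).mp (hG.2 e he)
        have hlt : φ u < ⟨i, by omega⟩ := by
          have h3 : φ u ≠ ⟨i, by omega⟩ := by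
            rintro h
            rw [← h, Equiv.symm_apply_apply] at h1
            exact hu h1
          have h4 : (φ u : ℕ) ≠ i := fun h => h3 (Fin.ext h)
          have := (φ u).2
          rw [Fin.lt_def]
          simp only
          omega
        simp only at h2
        have : s (φ.symm ⟨i, by omega⟩) e = true := by
          simp only [s, Equiv.apply_symm_apply, decide_eq_true_eq]
          exact ⟨h2, u, hu, hlt⟩
        simp [this, hs₀]

/-! ### Compactness of the density matrices and attainment -/

section Density

variable {n : Type*} [Fintype n]

theorem isClosed_posSemidef : IsClosed {ρ : Matrix n n ℂ | ρ.PosSemidef} := by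
  have : {ρ : Matrix n n ℂ | ρ.PosSemidef} =
      {ρ | ρᴴ = ρ} ∩ ⋂ x : n → ℂ, {ρ | 0 ≤ star x ⬝ᵥ (ρ *ᵥ x)} := by
    ext ρ
    simp [Matrix.posSemidef_iff_dotProduct_mulVec, Matrix.IsHermitian]
  rw [this]
  refine (isClosed_eq (by fun_prop) (by fun_prop)).inter (isClosed_iInter fun x => ?_)
  exact isClosed_le continuous_const (by fun_prop)

theorem isCompact_density : IsCompact {ρ : Matrix n n ℂ | IsDensity ρ} := by
  have hK : IsCompact (Set.univ.pi fun _ : n => Set.univ.pi fun _ : n =>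
      Metric.closedBall (0 : ℂ) 1) :=
    isCompact_univ_pi fun _ => isCompact_univ_pi fun _ => isCompact_closedBall 0 1
  refine IsCompact.of_isClosed_subset hK ?_ ?_
  · exact isClosed_posSemidef.inter (isClosed_eq (by fun_prop) continuous_const)
  · intro ρ hρ i _ j _
    have := hρ.1.norm_apply_le_trace i j
    rw [hρ.2] at this
    simpa using this

theorem convex_density : Convex ℝ {ρ : Matrix n n ℂ | IsDensity ρ} := by
  intro ρ hρ σ hσ a b ha hb hab
  refine ⟨(hρ.1.smul ha).add (hσ.1.smul hb), ?_⟩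
  rw [Matrix.trace_add, Matrix.trace_smul, Matrix.trace_smul, hρ.2, hσ.2, ← add_smul, hab,
    one_smul]

theorem one_mem_feasibleWeights {F : Set (Matrix n n ℂ)} (hF : F.Nonempty) {ρ : Matrix n n ℂ}
    (hρ : IsDensity ρ) : 1 ∈ feasibleWeights F ρ := by
  obtain ⟨σ, hσ⟩ := hF
  exact ⟨σ, hσ, by simpa using hρ.1⟩

/-- Taking traces shows `0 ≤ p`, and `p = 1` is feasible, so the search is confined to the compact
set `[0, 1] × F`. -/
theorem isLeast_sInf_feasibleWeights {F : Set (Matrix n n ℂ)} (hF : IsCompact F)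
    (hne : F.Nonempty) (hd : ∀ σ ∈ F, IsDensity σ) {ρ : Matrix n n ℂ} (hρ : IsDensity ρ) :
    IsLeast (feasibleWeights F ρ) (sInf (feasibleWeights F ρ)) := by
  have hcomp : IsCompact (Prod.fst '' ((Set.Icc (0 : ℝ) 1 ×ˢ F) ∩
      {q | (ρ - (1 - q.1) • q.2).PosSemidef})) := by
    refine IsCompact.image ?_ continuous_fst
    refine (isCompact_Icc.prod hF).inter_right ?_
    exact isClosed_posSemidef.preimage (by fun_prop)
  obtain ⟨σ₀, hσ₀⟩ := hne
  obtain ⟨p, ⟨⟨p, σ⟩, ⟨⟨hp, hσ⟩, hq⟩, rfl⟩, hmin⟩ := hcomp.exists_isLeast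
    ⟨1, (1, σ₀), ⟨⟨by simp, hσ₀⟩, by simpa using hρ.1⟩, rfl⟩
  have hleast : IsLeast (feasibleWeights F ρ) p := by
    refine ⟨⟨σ, hσ, hq⟩, ?_⟩
    rintro p' ⟨σ', hσ', hq'⟩
    have h0 : 0 ≤ p' := by
      have := (Complex.nonneg_iff.mp hq'.trace_nonneg).1
      rw [Matrix.trace_sub, Matrix.trace_smul, hρ.2, (hd _ hσ').2] at this
      simpa using this
    rcases le_or_gt p' 1 with h1 | h1
    · exact hmin ⟨(p', σ'), ⟨⟨⟨h0, h1⟩, hσ'⟩, hq'⟩, rfl⟩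
    · exact hp.2.trans h1.le
  rwa [hleast.csInf_eq]

end Density

variable {d : ℕ}

/-! ### Marginals and product states -/

section Marginal

theorem localOperator_apply (v : V) (A : Matrix (Fin d) (Fin d) ℂ) (a b : V → Fin d) :
    localOperator v A a b = A (a v) (b v) * if ∀ u, u ≠ v → a u = b u then 1 else 0 := by
  rw [localOperator, tensor_apply, ← Finset.mul_prod_erase _ _ (Finset.mem_univ v), if_pos rfl]
  congr 1
  split_ifs with h
  · refine Finset.prod_eq_one fun u hu => ?_
    have hu := Finset.ne_of_mem_erase hu
    rw [if_neg hu, h u hu, Matrix.one_apply_eq]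
  · push Not at h
    obtain ⟨u, huv, hu⟩ := h
    refine Finset.prod_eq_zero (i := u) (by simp [huv]) ?_
    simp [huv, hu]

theorem localOperator_one (v : V) : localOperator v (1 : Matrix (Fin d) (Fin d) ℂ) = 1 := by
  simp only [localOperator, ite_self]
  exact tensor_one

theorem localOperator_sub (v : V) (A B : Matrix (Fin d) (Fin d) ℂ) :
    localOperator v (A - B) = localOperator v A - localOperator v B := by
  ext a b
  rw [Matrix.sub_apply, localOperator_apply, localOperator_apply, localOperator_apply, ← sub_mul,
    Matrix.sub_apply]

theorem localOperator_mul (v : V) (A B : Matrix (Fin d) (Fin d) ℂ) :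
    localOperator v A * localOperator v B = localOperator v (A * B) := by
  rw [localOperator, localOperator, localOperator, tensor_mul]
  congr 1
  ext1 u
  split_ifs <;> simp

theorem localOperator_conjTranspose (v : V) (A : Matrix (Fin d) (Fin d) ℂ) :
    (localOperator v A)ᴴ = localOperator v Aᴴ := by
  rw [localOperator, localOperator, tensor_conjTranspose]
  congr 1
  ext1 u
  split_ifs <;> simp

theorem trace_localOperator_mul (v : V) (A : Matrix (Fin d) (Fin d) ℂ) (ω : Operator V d) :
    (localOperator v A * ω).trace = (A * marginal ω v).trace := by
  have h : localOperator v A = ∑ i, ∑ j, A i j • localOperator v (Matrix.single i j 1) := by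
    ext a b
    simp only [Matrix.sum_apply, Matrix.smul_apply, localOperator_apply, smul_eq_mul]
    rw [Finset.sum_eq_single (a v), Finset.sum_eq_single (b v)]
    · simp
    · intro j _ hj
      simp [hj]
    · simp
    · intro i _ hi
      simp [hi]
    · simp
  rw [h]
  simp only [Finset.sum_mul, Matrix.trace_sum, Matrix.smul_mul, Matrix.trace_smul, smul_eq_mul]
  conv_rhs => rw [Matrix.trace]
  simp only [Matrix.diag_apply, Matrix.mul_apply, marginal, Matrix.of_apply]

theorem isDensity_marginal {ω : Operator V d} (hω : IsDensity ω) (v : V) :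
    IsDensity (marginal ω v) := by
  refine ⟨Matrix.PosSemidef.of_dotProduct_mulVec_nonneg ?_ fun z => ?_, ?_⟩
  · ext i j
    simp only [Matrix.conjTranspose_apply, marginal, Matrix.of_apply]
    rw [← Matrix.trace_conjTranspose, Matrix.conjTranspose_mul, localOperator_conjTranspose,
      hω.1.isHermitian.eq, Matrix.trace_mul_comm]
    simp
  · have h1 : star z ⬝ᵥ (marginal ω v *ᵥ z) =
        (localOperator v (Matrix.vecMulVec z (star z)) * ω).trace := by
      rw [trace_localOperator_mul, Matrix.vecMulVec_mul, Matrix.trace_vecMulVec,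
        Matrix.dotProduct_mulVec, dotProduct_comm]
    rw [h1]
    refine Matrix.PosSemidef.trace_mul_nonneg (tensor_posSemidef fun u => ?_) hω.1
    split_ifs
    · exact Matrix.posSemidef_vecMulVec_self_star z
    · exact Matrix.PosSemidef.one
  · rw [← Matrix.one_mul (marginal ω v), ← trace_localOperator_mul, localOperator_one,
      Matrix.one_mul, hω.2]

/-- A state with pure one-party marginals is the product of its marginals. -/
theorem eq_tensor_marginal {ω : Operator V d} (hω : IsDensity ω)
    (h : ∀ v, 1 ≤ (marginal ω v * marginal ω v).trace.re) : ω = tensor (marginal ω) := by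
  have hm := fun v => isDensity_marginal hω v
  have hpure := fun v => (hm v).1.exists_eq_vecMulVec_of_trace_sq (hm v).2 (h v)
  have hloc : ∀ v, localOperator v (marginal ω v) * ω = ω := by
    intro v
    -- The pure marginal is a projection, and its complement has expectation zero in `ω`, hence
    -- annihilates `ω`.
    have hQ : (localOperator v (1 - marginal ω v))ᴴ * localOperator v (1 - marginal ω v) =
        localOperator v (1 - marginal ω v) := by
      rw [localOperator_conjTranspose, localOperator_mul, Matrix.conjTranspose_sub,
        Matrix.conjTranspose_one, (hm v).1.isHermitian.eq, Matrix.sub_mul, Matrix.mul_sub,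
        Matrix.mul_sub, (hpure v).1]
      simp
    have h0 : localOperator v (1 - marginal ω v) * ω = 0 := by
      refine hω.1.mul_eq_zero_of_trace ?_
      rw [hQ, trace_localOperator_mul, Matrix.sub_mul, (hpure v).1]
      simp
    rw [localOperator_sub, localOperator_one, Matrix.sub_mul, Matrix.one_mul, sub_eq_zero] at h0
    exact h0.symm
  have hT : tensor (marginal ω) * ω = ω := by
    have : ∀ s : Finset V, tensor (fun v => if v ∈ s then marginal ω v else 1) * ω = ω := by
      intro s
      induction s using Finset.induction_on with
      | empty => simp [tensor_one]
      | insert a s ha ih =>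
        have heq : tensor (fun v => if v ∈ insert a s then marginal ω v else 1) =
            localOperator a (marginal ω a) *
              tensor (fun v => if v ∈ s then marginal ω v else 1) := by
          rw [localOperator, tensor_mul]
          congr 1
          ext1 v
          by_cases hv : v = a
          · subst hv
            simp [ha]
          · simp [hv]
        rw [heq, Matrix.mul_assoc, ih, hloc]
    simpa using this Finset.univ
  have hTH : (tensor (marginal ω))ᴴ = tensor (marginal ω) :=
    (tensor_posSemidef fun v => (hm v).1).isHermitian.eq
  have hT' : ω * tensor (marginal ω) = ω := by
    have := congrArg Matrix.conjTranspose hT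
    rwa [Matrix.conjTranspose_mul, hTH, hω.1.isHermitian.eq] at this
  choose u hu using fun v => (hpure v).2
  have hvec : tensor (marginal ω) =
      Matrix.vecMulVec (fun x => ∏ v, u v (x v)) (star fun x => ∏ v, u v (x v)) := by
    ext x y
    rw [tensor_apply, Matrix.vecMulVec_apply, Pi.star_apply, star_prod, ← Finset.prod_mul_distrib]
    refine Finset.prod_congr rfl fun v _ => ?_
    conv_lhs => rw [hu v]
    rfl
  -- `ω` is compressed by the rank-one projection `tensor (marginal ω)`, so it is a multiple of it;
  -- the trace fixes the factor.
  obtain ⟨c, hc⟩ : ∃ c : ℂ, ω = c • tensor (marginal ω) := by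
    refine ⟨(star fun x => ∏ v, u v (x v)) ⬝ᵥ (ω *ᵥ fun x => ∏ v, u v (x v)), ?_⟩
    calc ω = tensor (marginal ω) * (ω * tensor (marginal ω)) := by rw [hT', hT]
      _ = _ := by
        rw [hvec, Matrix.mul_vecMulVec, Matrix.vecMulVec_mul_vecMulVec, Matrix.vecMulVec_smul]
  have htr := congrArg Matrix.trace hc
  rw [Matrix.trace_smul, hω.2, (isDensity_tensor hm).2, smul_eq_mul, mul_one] at htr
  rwa [← htr, one_smul] at hc

theorem continuous_marginal (v : V) : Continuous fun ω : Operator V d => marginal ω v := by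
  unfold marginal
  refine continuous_matrix fun i j => ?_
  simp only [Matrix.of_apply]
  fun_prop

end Marginal

/-! ### The total defect under mixtures and components -/

section Defect

theorem totalDefect_sum {ι : Type*} (s : Finset ι) (ε : ℝ) (w : ι → ℝ) (z : ι → Operator V d)
    (hw : ∑ i ∈ s, w i = 1) :
    totalDefect ε (∑ i ∈ s, w i • z i) = ∑ i ∈ s, w i * totalDefect ε (z i) := by
  have h : ∀ x y, swapDefect ε (∑ i ∈ s, w i • z i) x y =
      ∑ i ∈ s, w i * swapDefect ε (z i) x y := by
    intro x y
    simp only [swapDefect, Finset.mul_sum, Matrix.mul_smul, Matrix.trace_sum, Matrix.trace_smul,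
      Complex.re_sum, mul_sub, mul_one, Finset.sum_sub_distrib, hw, Complex.smul_re, smul_eq_mul]
    congr 1
    exact Finset.sum_congr rfl fun i _ => by ring
  simp only [totalDefect, h, Finset.mul_sum]
  rw [Finset.sum_comm]

theorem continuous_totalDefect (ε : ℝ) : Continuous (totalDefect ε : Operator V d → ℝ) := by
  unfold totalDefect swapDefect
  fun_prop

/-- A component of a state with vanishing defect has vanishing defect. -/
theorem totalDefect_nonpos_of_posSemidef_sub {ε : ℝ} (hε : ε * ε = 1) {ρ σ : Operator V d}
    (hρ : IsDensity ρ) (hσ : IsDensity σ) (h0 : totalDefect ε ρ = 0) {p : ℝ} (hp : p < 1)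
    (h : (ρ - (1 - p) • σ).PosSemidef) : totalDefect ε σ ≤ 0 := by
  -- The positive operator `(1 - εF)ᴴ(1 - εF)` has nonnegative expectation in the remainder `ρ - (1
  -- - p) σ`.
  have hle : ∀ x y, (1 - p) * swapDefect ε σ x y ≤ swapDefect ε ρ x y := by
    intro x y
    have h1 := (Complex.nonneg_iff.mp ((Matrix.posSemidef_conjTranspose_mul_self
      (1 - ε • permOperator d (Equiv.swap x y))).trace_mul_nonneg h)).1
    rw [Matrix.mul_sub, Matrix.mul_smul, Matrix.trace_sub, Matrix.trace_smul, Complex.sub_re,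
      Complex.smul_re, weighted_norm_one_sub_swap hε hρ.2,
      weighted_norm_one_sub_swap hε hσ.2, smul_eq_mul] at h1
    linarith
  have h2 : (1 - p) * totalDefect ε σ ≤ totalDefect ε ρ := by
    rw [totalDefect, totalDefect, Finset.mul_sum]
    exact Finset.sum_le_sum fun q _ => hle q.1 q.2
  rw [h0] at h2
  exact nonpos_of_mul_nonpos_right h2 (by linarith)

theorem totalDefect_eq_zero_of_isSymmetricState {ρ : Operator V d} (hρ : IsDensity ρ)
    (h : IsSymmetricState ρ) : totalDefect 1 ρ = 0 := by
  refine Finset.sum_eq_zero fun q _ => ?_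
  simp [swapDefect, h _, hρ.2]

theorem totalDefect_eq_zero_of_isAntisymmetricState {ρ : Operator V d} (hρ : IsDensity ρ)
    (h : IsAntisymmetricState ρ) : totalDefect (-1) ρ = 0 := by
  refine Finset.sum_eq_zero fun q hq => ?_
  have hne : q.1 ≠ q.2 := (Finset.mem_offDiag.mp hq).2.2
  simp [swapDefect, h _, hρ.2, Equiv.Perm.sign_swap hne]

end Defect

/-! ### Separable states -/

section Separable

theorem isCompact_separableStates {V : Type*} [Fintype V] {d : ℕ} :
    IsCompact (separableStates V d) := by
  refine IsCompact.convexHull_of_finiteDimensional ?_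
  have : {σ : Operator V d | ∃ ω : V → Matrix (Fin d) (Fin d) ℂ,
      (∀ v, IsDensity (ω v)) ∧ σ = tensor ω} =
      (fun ω : V → Matrix (Fin d) (Fin d) ℂ => (tensor ω : Operator V d)) ''
        Set.univ.pi fun _ => {ω | IsDensity ω} := by
    ext σ
    simp [Set.mem_pi, eq_comm]
  rw [this]
  refine (isCompact_univ_pi fun _ => isCompact_density).image ?_
  unfold tensor
  refine continuous_matrix fun i j => ?_
  simp only [Matrix.of_apply]
  fun_prop

theorem isDensity_of_mem_separableStates {σ : Operator V d} (h : σ ∈ separableStates V d) :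
    IsDensity σ := by
  refine convexHull_min ?_ convex_density h
  rintro _ ⟨ω, hω, rfl⟩
  exact isDensity_tensor hω

/-- The state `ρ` is needed because no one-party density matrix exists for `d = 0`. -/
theorem separableStates_nonempty {ρ : Operator V d} (hρ : IsDensity ρ) :
    (separableStates V d).Nonempty :=
  ⟨_, subset_convexHull ℝ _ ⟨marginal ρ, isDensity_marginal hρ, rfl⟩⟩

/-- Local channels can prepare any product state from a one-dimensional system. -/
theorem exists_applyLocal_eq_tensor {α : V → Type*} [∀ v, Fintype (α v)] [∀ v, DecidableEq (α v)]
    [∀ v, Unique (α v)] {X : Matrix (∀ v, α v) (∀ v, α v) ℂ} (hX : ∀ a b, X a b = 1)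
    {ω : V → Matrix (Fin d) (Fin d) ℂ} (hω : ∀ v, IsDensity (ω v)) :
    ∃ C : ∀ v, Channel (α v) (Fin d), applyLocal C X = tensor ω := by
  have hX1 : X = 1 := by
    ext a b
    rw [hX, Subsingleton.elim a b, Matrix.one_apply_eq]
  choose B hB using fun v => (hω v).1.exists_eq_mul_conjTranspose
  have htr : ∀ v, ∑ k, ∑ i, star (B v i k) * B v i k = 1 := by
    intro v
    rw [← (hω v).2, hB v, Matrix.trace_mul_comm]
    simp [Matrix.trace, Matrix.mul_apply]
  -- The Kraus operators are the columns of `B v`, where `ω v = B v * (B v)ᴴ`; trace preservation is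
  -- `Tr (ω v) = 1`.
  refine ⟨fun v => ⟨d, fun k => Matrix.of fun i _ => B v i k, ?_⟩, ?_⟩
  · ext a b
    rw [Subsingleton.elim a b, Matrix.one_apply_eq, Matrix.sum_apply, ← htr v]
    simp [Matrix.mul_apply]
  · simp only [hX1, applyLocal, Matrix.mul_one, tensor_conjTranspose, tensor_mul]
    rw [sum_tensor fun v k => (Matrix.of fun (i : Fin d) (_ : α v) => B v i k) *
      (Matrix.of fun (i : Fin d) (_ : α v) => B v i k)ᴴ]
    congr 1
    ext v i j
    rw [hB v, Matrix.sum_apply]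
    simp [Matrix.mul_apply]

instance (e : Set V) : Unique (SourceBasis (fun _ _ => 1) e) :=
  inferInstanceAs (Unique ((v : e) → Fin 1))

instance (G : Hypergraph V) (v : V) : Unique (PartyBasis G (fun _ _ => 1) v) :=
  inferInstanceAs (Unique ((e : {e : Set V // e ∈ G.edgeSet ∧ v ∈ e}) → Fin 1))

/-- One-dimensional sources suffice: the channels prepare the product states and the shared
randomness mixes them. -/
theorem separableStates_subset_networkStates (G : Hypergraph V) :
    separableStates V d ⊆ networkStates G d := by
  classical
  intro σ hσ
  refine subset_closure ?_
  have hτ : ∀ e : Set V, IsDensity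
      (Matrix.of fun _ _ => 1 :
        Matrix (SourceBasis (fun _ _ => 1) e) (SourceBasis (fun _ _ => 1) e) ℂ) := by
    intro e
    have h1 : (Matrix.of fun _ _ => 1 :
        Matrix (SourceBasis (fun _ _ => 1) e) (SourceBasis (fun _ _ => 1) e) ℂ) = 1 := by
      ext a b
      rw [Subsingleton.elim a b, Matrix.one_apply_eq, Matrix.of_apply]
    rw [h1]
    exact ⟨Matrix.PosSemidef.one, by simp⟩
  refine ⟨fun _ _ => 1, fun e => Matrix.of fun _ _ => 1, fun e => hτ e, ?_⟩
  have hX : ∀ a b, distribute G (fun _ _ => 1) (fun e => Matrix.of fun _ _ => 1) a b = 1 := by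
    intro a b
    exact Finset.prod_eq_one fun e _ => rfl
  obtain ⟨ι, _, w, z, hw0, hw1, hz, rfl⟩ := mem_convexHull_iff_exists_fintype.mp hσ
  choose ω hω hzω using hz
  choose C hC using fun i => exists_applyLocal_eq_tensor (α := PartyBasis G fun _ _ => 1) hX (hω i)
  let φ := Fintype.equivFin ι
  refine ⟨Fintype.card ι, w ∘ φ.symm, fun l => C (φ.symm l), fun l => hw0 _, ?_, ?_⟩
  · rw [← hw1]
    exact φ.symm.sum_comp w
  · rw [← φ.symm.sum_comp]
    simp only [hC, Function.comp_apply, hzω]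

end Separable

/-! ### Bounds on the network states -/

section Network

/-- A closed convex set that contains the states prepared without shared randomness contains all
the states in `S_C(G)`. -/
theorem networkStates_subset {G : Hypergraph V} {K : Set (Operator V d)} (hK : IsClosed K)
    (hconv : Convex ℝ K)
    (h : ∀ (D : Set V → V → ℕ)
      (τ : ∀ e : G.edgeSet, Matrix (SourceBasis D (e : Set V)) (SourceBasis D (e : Set V)) ℂ),
      (∀ e, IsDensity (τ e)) → ∀ C : ∀ v, Channel (PartyBasis G D v) (Fin d),
        applyLocal C (distribute G D τ) ∈ K) :
    networkStates G d ⊆ K := by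
  refine closure_minimal ?_ hK
  rintro σ ⟨D, τ, hτ, N, p, C, hp0, hp1, rfl⟩
  exact hconv.sum_mem (fun l _ => hp0 l) hp1 fun l _ => h D τ hτ (C l)

theorem isDensity_of_mem_networkStates {G : Hypergraph V} {σ : Operator V d}
    (h : σ ∈ networkStates G d) : IsDensity σ :=
  networkStates_subset isCompact_density.isClosed convex_density
    (fun _ τ hτ C => isDensity_applyLocal C (isDensity_distribute τ hτ)) h

/-- For `ε = -1` the chain bound has left side `1 + Tr(m²) ≥ 1`, and the resulting inequality is
closed and affine in the state. -/
theorem one_le_totalDefect_of_mem_networkStates (hV : 2 ≤ Fintype.card V) {G : Hypergraph V}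
    (hG : IsNetwork G) {σ : Operator V d} (h : σ ∈ networkStates G d) :
    1 ≤ 9 ^ (Fintype.card V - 1) * totalDefect (-1) σ := by
  obtain ⟨v₀⟩ : Nonempty V := Fintype.card_pos_iff.mp (by omega)
  refine networkStates_subset
    (K := {σ | 1 ≤ 9 ^ (Fintype.card V - 1) * totalDefect (-1) σ}) ?_ ?_ ?_ h
  · exact isClosed_le continuous_const (continuous_const.mul (continuous_totalDefect _))
  · intro ρ hρ σ hσ a b ha hb hab
    have hlin := totalDefect_sum Finset.univ (-1) ![a, b] ![ρ, σ] (by simpa using hab)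
    simp only [Fin.sum_univ_two, Matrix.cons_val_zero, Matrix.cons_val_one] at hlin
    simp only [Set.mem_ofPred_eq] at hρ hσ ⊢
    rw [hlin]
    nlinarith
  · intro D τ hτ C
    have h1 := one_sub_marginal_sq_le hV hG hτ C (ε := -1) (by norm_num) v₀
    have hm := (isDensity_marginal (isDensity_applyLocal C (isDensity_distribute τ hτ)) v₀).1
    have h2 := (Complex.nonneg_iff.mp (hm.trace_mul_nonneg hm)).1
    simp only [Set.mem_ofPred_eq]
    linarith

/-- Symmetric states that a network can prepare are fully separable. -/
theorem mem_separableStates_of_totalDefect_nonpos (hV : 2 ≤ Fintype.card V) {G : Hypergraph V}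
    (hG : IsNetwork G) {σ : Operator V d} (h : σ ∈ networkStates G d)
    (h0 : totalDefect 1 σ ≤ 0) : σ ∈ separableStates V d := by
  -- The purity bound is not preserved by mixing, so it is kept on the compact set `K`. As
  -- `convexHull ℝ K` is closed, even limit states are finite mixtures from `K`.
  let K : Set (Operator V d) := {ω | IsDensity ω} ∩ {ω | ∀ v,
    1 - (marginal ω v * marginal ω v).trace.re ≤ 9 ^ (Fintype.card V - 1) * totalDefect 1 ω}
  have hK : IsCompact K := by
    refine isCompact_density.inter_right ?_
    rw [Set.ofPred_forall]
    refine isClosed_iInter fun v => isClosed_le ?_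
      (continuous_const.mul (continuous_totalDefect _))
    have := continuous_marginal (d := d) v
    fun_prop
  have hmem : σ ∈ convexHull ℝ K := by
    refine networkStates_subset hK.convexHull_of_finiteDimensional.isClosed (convex_convexHull ℝ K)
      (fun D τ hτ C => subset_convexHull ℝ K
        ⟨isDensity_applyLocal C (isDensity_distribute τ hτ), fun v => ?_⟩) h
    simpa using one_sub_marginal_sq_le hV hG hτ C (ε := 1) (by norm_num) v
  obtain ⟨ι, _, w, z, hw0, hw1, hz, rfl⟩ := mem_convexHull_iff_exists_fintype.mp hmem
  rw [totalDefect_sum _ _ _ _ hw1] at h0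
  have hnn : ∀ i, 0 ≤ totalDefect 1 (z i) := fun i =>
    totalDefect_nonneg (by norm_num) (hz i).1
  have hzero : ∀ i, w i * totalDefect 1 (z i) = 0 := fun i =>
    (Finset.sum_eq_zero_iff_of_nonneg fun i _ => mul_nonneg (hw0 i) (hnn i)).mp
      (le_antisymm h0 (Finset.sum_nonneg fun i _ => mul_nonneg (hw0 i) (hnn i))) i
      (Finset.mem_univ i)
  classical
  rw [← Finset.sum_filter_of_ne (p := fun i => w i ≠ 0)
    fun i _ hi hwi => hi (by rw [hwi, zero_smul])]
  refine (convex_convexHull ℝ _).sum_mem (fun i _ => hw0 i) ?_ fun i hi => ?_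
  · rw [Finset.sum_filter_ne_zero, hw1]
  · have hwi := (Finset.mem_filter.mp hi).2
    have hd := (mul_eq_zero.mp (hzero i)).resolve_left hwi
    refine subset_convexHull ℝ _ ⟨marginal (z i), isDensity_marginal (hz i).1,
      eq_tensor_marginal (hz i).1 fun v => ?_⟩
    have := (hz i).2 v
    rw [hd] at this
    linarith

end Network

/-! ### The weights of anti-symmetric and symmetric states -/

theorem isLeast_one_feasibleWeights_of_isAntisymmetricState (hV : 2 ≤ Fintype.card V)
    {ρ : Operator V d} (hρ : IsDensity ρ) (h : IsAntisymmetricState ρ) {G : Hypergraph V}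
    (hG : IsNetwork G) : IsLeast (feasibleWeights (networkStates G d) ρ) 1 := by
  refine ⟨one_mem_feasibleWeights
    ((separableStates_nonempty hρ).mono (separableStates_subset_networkStates G)) hρ, ?_⟩
  rintro p ⟨σ, hσ, hp⟩
  by_contra! hlt
  have h1 := totalDefect_nonpos_of_posSemidef_sub (by norm_num) hρ
    (isDensity_of_mem_networkStates hσ)
    (totalDefect_eq_zero_of_isAntisymmetricState hρ h) hlt hp
  have h2 := one_le_totalDefect_of_mem_networkStates hV hG hσ
  have h3 : (0 : ℝ) < 9 ^ (Fintype.card V - 1) := by positivity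
  linarith [mul_nonpos_of_nonneg_of_nonpos h3.le h1]

theorem feasibleWeights_networkStates_of_isSymmetricState (hV : 2 ≤ Fintype.card V)
    {ρ : Operator V d} (hρ : IsDensity ρ) (h : IsSymmetricState ρ) {G : Hypergraph V}
    (hG : IsNetwork G) :
    feasibleWeights (networkStates G d) ρ = feasibleWeights (separableStates V d) ρ := by
  apply Set.Subset.antisymm
  · rintro p ⟨σ, hσ, hp⟩
    rcases lt_or_ge p 1 with hlt | hge
    · exact ⟨σ, mem_separableStates_of_totalDefect_nonpos hV hG hσ
        (totalDefect_nonpos_of_posSemidef_sub (by norm_num) hρ (isDensity_of_mem_networkStates hσ)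
          (totalDefect_eq_zero_of_isSymmetricState hρ h) hlt hp), hp⟩
    -- For `p ≥ 1` every separable state is a witness, since `ρ + (p - 1) σ'` is positive
    -- semidefinite.
    · obtain ⟨σ', hσ'⟩ := separableStates_nonempty hρ
      refine ⟨σ', hσ', ?_⟩
      rw [sub_eq_add_neg, ← neg_smul, neg_sub]
      exact hρ.1.add ((isDensity_of_mem_separableStates hσ').1.smul (sub_nonneg.mpr hge))
  · rintro p ⟨σ, hσ, hp⟩
    exact ⟨σ, separableStates_subset_networkStates G hσ, hp⟩

end QuantumNetwork

end

theorem mainTheorem5 {V : Type*} [Fintype V] [DecidableEq V] (hV : 2 ≤ Fintype.card V)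
    (d : ℕ) (ρ : QuantumNetwork.Operator V d) (hρ : QuantumNetwork.IsDensity ρ) :
    (QuantumNetwork.IsAntisymmetricState ρ →
      ∀ G : Hypergraph V, QuantumNetwork.IsNetwork G →
        IsLeast (QuantumNetwork.feasibleWeights (QuantumNetwork.networkStates G d) ρ)
          (QuantumNetwork.networkWeight G ρ) ∧
        QuantumNetwork.networkWeight G ρ = 1) ∧
    (QuantumNetwork.IsSymmetricState ρ →
      IsLeast (QuantumNetwork.feasibleWeights (QuantumNetwork.separableStates V d) ρ)
        (QuantumNetwork.entanglementWeight ρ) ∧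
      (∀ G : Hypergraph V, QuantumNetwork.IsNetwork G →
        IsLeast (QuantumNetwork.feasibleWeights (QuantumNetwork.networkStates G d) ρ)
          (QuantumNetwork.networkWeight G ρ) ∧
        QuantumNetwork.networkWeight G ρ = QuantumNetwork.entanglementWeight ρ) ∧
      ∀ G G' : Hypergraph V, QuantumNetwork.IsNetwork G → QuantumNetwork.IsNetwork G' →
        QuantumNetwork.networkWeight G ρ = QuantumNetwork.networkWeight G' ρ) := by
  refine ⟨fun h G hG => ?_, fun h => ?_⟩
  · have hl := QuantumNetwork.isLeast_one_feasibleWeights_of_isAntisymmetricState hV hρ h hG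
    have hw : QuantumNetwork.networkWeight G ρ = 1 := hl.csInf_eq
    exact ⟨hw ▸ hl, hw⟩
  · have hsep : IsLeast (QuantumNetwork.feasibleWeights (QuantumNetwork.separableStates V d) ρ)
      (QuantumNetwork.entanglementWeight ρ) :=
      QuantumNetwork.isLeast_sInf_feasibleWeights QuantumNetwork.isCompact_separableStates
        (QuantumNetwork.separableStates_nonempty hρ)
        (fun σ hσ => QuantumNetwork.isDensity_of_mem_separableStates hσ) hρ
    have hF := fun (G : Hypergraph V) (hG : QuantumNetwork.IsNetwork G) =>
      QuantumNetwork.feasibleWeights_networkStates_of_isSymmetricState hV hρ h hG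
    have hw : ∀ G : Hypergraph V, QuantumNetwork.IsNetwork G →
        QuantumNetwork.networkWeight G ρ = QuantumNetwork.entanglementWeight ρ :=
      fun G hG => congrArg sInf (hF G hG)
    refine ⟨hsep, fun G hG => ⟨?_, hw G hG⟩, fun G G' hG hG' => (hw G hG).trans (hw G' hG').symm⟩
    rw [hw G hG, hF G hG]
    exact hsep
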